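/- Let $K$ be a field of characteristic zero (for instance $K=\mathbb{R}$ or $\mathbb{C}$), and let $J^k$ be the space of $k$-jets of maps $(f,h):K^6\to K^2$ of the variables $u_1,u_2,u_3,v_1,v_2,v_3$, i.e. the affine space over $K$ whose coordinates are the independent variables and the partial derivatives of $f$ and $h$ of order $\le k$ (so $\dim J^2=62$, $\dim J^3=174$), with projections $\pi_{3,2}:J^3\to J^2$. Let $\mathcal{E}_2\subset J^2$ be given by the 20 conditions of linear degeneracy $$\mathrm{Sym}_{\{i,j,k\}}\big((f_{u_k}-h_{v_k})f_{u_iu_j}+h_{u_k}(f_{u_iv_j}+f_{u_jv_i})+f_{v_k}h_{u_iu_j}+h_{u_k}h_{v_iv_j}\big)=0,$$ $$\mathrm{Sym}_{\{i,j,k\}}\big((h_{v_k}-f_{u_k})h_{v_iv_j}+f_{v_k}(h_{u_iv_j}+h_{u_jv_i})+h_{u_k}f_{v_iv_j}+f_{v_k}f_{u_iu_j}\big)=0,$$ where $i,j,k\in\{1,2,3\}$ and $\mathrm{Sym}$ is complete symmetrisation, and let $\mathcal{E}_3\subset J^3$ be its first prolongation, given by these equations together with all their first total derivatives with respect to the six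 independent variables. Call a jet non-degenerate if $\det(g^{ij})\neq 0$, where $g^{ij}=\tfrac12(F_{u_i}H_{v_j}+F_{u_j}H_{v_i}-F_{v_i}H_{u_j}-F_{v_j}H_{u_i})$, $1\le i,j\le 4$, with $F=u_4-f$, $H=v_4-h$ (this depends only on the 1-jet). Let $J^2_{\mathrm{nd}}\subset J^2$ be the Zariski open set of non-degenerate 2-jets and let $\tilde{\mathcal{E}}_2=\pi_{3,2}(\mathcal{E}_3)\cap J^2_{\mathrm{nd}}$. Then $\tilde{\mathcal{E}}_2=\tilde{\mathcal{E}}_2'\cup\tilde{\mathcal{E}}_2''$ is a reducible algebraic subvariety (Zariski closed subset) of $J^2_{\mathrm{nd}}$ with exactly two irreducible components: $\tilde{\mathcal{E}}_2'$, of codimension 24, and $\tilde{\mathcal{E}}_2''$, of codimension 30, in $J^2$. The intersection $\tilde{\mathcal{E}}_2'\cap\tilde{\mathcal{E}}_2''$ is an irreducible algebraic subvariety of $J^2_{\mathrm{nd}}$, of codimension 34 in $J^2$. -/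

import Mathlib

namespace LinDeg

open MvPolynomial

/-! ### Zariski topology and codimension in a finite-dimensional affine space -/

/-- The Zariski topology on the affine space `σ → K`: closed sets are the zero loci of ideals of
polynomials. -/
@[reducible] def zariski (σ K : Type*) [Field K] : TopologicalSpace (σ → K) :=
  TopologicalSpace.ofClosed {Z | ∃ I : Ideal (MvPolynomial σ K), Z = zeroLocus K I}
    ⟨⊤, by simp⟩
    (by
      intro A hA
      choose I hI using hA
      refine ⟨⨆ Z : A, I Z.2, ?_⟩
      ext x
      have key : x ∈ zeroLocus K (⨆ Z : A, I Z.2) ↔ ∀ Z : A, x ∈ zeroLocus K (I Z.2) := by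
        have h := fun J : Ideal (MvPolynomial σ K) =>
          le_zeroLocus_iff_le_vanishingIdeal (K := K) (V := {x}) (I := J)
        simp only [Set.singleton_subset_iff] at h
        simp only [h, iSup_le_iff]
      rw [key, Set.mem_sInter]
      constructor
      · intro hx Z
        rw [← hI Z.2]
        exact hx _ Z.2
      · intro hx Z hZ
        rw [hI hZ]
        exact hx ⟨Z, hZ⟩)
    (by
      rintro _ ⟨I, rfl⟩ _ ⟨J, rfl⟩
      refine ⟨I * J, ?_⟩
      ext x
      have h := fun L : Ideal (MvPolynomial σ K) =>
        le_zeroLocus_iff_le_vanishingIdeal (K := K) (V := {x}) (I := L)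
      simp only [Set.singleton_subset_iff] at h
      have hp : (vanishingIdeal K ({x} : Set (σ → K))).IsPrime := inferInstance
      rw [Set.mem_union, h, h, h, hp.mul_le])

/-- `S` is an algebraic subvariety of the (Zariski open) set `U`: a Zariski closed subset of `U`. -/
def IsClosedIn {σ K : Type*} [Field K] (U S : Set (σ → K)) : Prop :=
  ∃ Z : Set (σ → K), @IsClosed (σ → K) (zariski σ K) Z ∧ S = Z ∩ U

/-- `S` is irreducible for the Zariski topology (in particular nonempty). -/
def IsIrred {σ K : Type*} [Field K] (S : Set (σ → K)) : Prop :=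
  @IsIrreducible (σ → K) (zariski σ K) S

/-- The irreducible components of `S`: the maximal irreducible subsets of `S`. -/
def components {σ K : Type*} [Field K] (S : Set (σ → K)) : Set (Set (σ → K)) :=
  {T | Maximal (fun T' : Set (σ → K) => T' ⊆ S ∧ IsIrred T') T}

/-- The codimension of `S` in the affine space `σ → K`: the height of the ideal of all polynomials
vanishing on `S`. For irreducible `S` this ideal is prime, and its height is the codimension of the
Zariski closure of `S`. -/
noncomputable def codim {σ K : Type*} [Field K] (S : Set (σ → K)) : ℕ∞ :=
  (vanishingIdeal K S).height

/-! ### Jet spaces of pairs `(f, h)` of functions of `u₁, u₂, u₃, v₁, v₂, v₃` -/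

/-- Labels of the independent variables: `Sum.inl i` is `uᵢ`, `Sum.inr i` is `vᵢ`. -/
abbrev Base : Type := Fin 3 ⊕ Fin 3

/-- Labels of the coordinates on `J^k`: the six independent variables, and for each of the two
dependent variables (`0` is `f`, `1` is `h`) one coordinate for each partial derivative of order
`j ≤ k`; a partial derivative of order `j` is an unordered `j`-tuple of independent variables. -/
abbrev JetCoord (k : ℕ) : Type := Base ⊕ (Fin 2 × (Σ j : Fin (k + 1), Sym Base j))

/-- The jet space `J^k`. -/
abbrev Jet (K : Type*) (k : ℕ) : Type _ := JetCoord k → K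

/-- A coordinate on `J^k` regarded as a coordinate on `J^(k+1)`. -/
def JetCoord.lift {k : ℕ} : JetCoord k → JetCoord (k + 1)
  | Sum.inl a => Sum.inl a
  | Sum.inr (m, ⟨j, s⟩) => Sum.inr (m, ⟨j.castSucc, s⟩)

/-- The projection `J^(k+1) → J^k`. -/
def proj {K : Type*} {k : ℕ} (q : Jet K (k + 1)) : Jet K k := fun c => q c.lift

/-- The value at `q ∈ J^(k+1)` of the total derivative, with respect to the independent variable
`a`, of a coordinate function on `J^k`: an independent variable `b` gives `1` or `0` according to
whether `b = a`, and the derivative `s` of `f` or `h` gives its derivative with respect to `a`. -/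
def totalDerivCoord {K : Type*} [Field K] {k : ℕ} (a : Base) (q : Jet K (k + 1)) : JetCoord k → K
  | Sum.inl b => if b = a then 1 else 0
  | Sum.inr (m, ⟨j, s⟩) => q (Sum.inr (m, ⟨j.succ, a ::ₛ s⟩))

/-- The value at `q ∈ J^(k+1)` of the total derivative `D_a P` of a polynomial function `P` on
`J^k`, by the chain rule. -/
noncomputable def totalDeriv {K : Type*} [Field K] {k : ℕ} (a : Base)
    (P : MvPolynomial (JetCoord k) K) (q : Jet K (k + 1)) : K :=
  ∑ c : JetCoord k, eval (proj q) (pderiv c P) * totalDerivCoord a q c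

/-! ### The conditions of linear degeneracy and their first prolongation -/

/-- The label on `J²` of the first-order derivative `∂_a` of `f` (`m = 0`) or `h` (`m = 1`). -/
def c1 (m : Fin 2) (a : Base) : JetCoord 2 :=
  Sum.inr (m, ⟨⟨1, by decide⟩, a ::ₛ Sym.nil⟩)

/-- The label on `J²` of the second-order derivative `∂_a ∂_b` of `f` (`m = 0`) or `h` (`m = 1`). -/
def c2 (m : Fin 2) (a b : Base) : JetCoord 2 :=
  Sum.inr (m, ⟨⟨2, by decide⟩, a ::ₛ b ::ₛ Sym.nil⟩)

/-- The independent variable `uᵢ`. -/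
abbrev u (i : Fin 3) : Base := Sum.inl i

/-- The independent variable `vᵢ`. -/
abbrev v (i : Fin 3) : Base := Sum.inr i

/-- The unsymmetrised expression
`(f_{u_k} - h_{v_k}) f_{u_i u_j} + h_{u_k} (f_{u_i v_j} + f_{u_j v_i}) + f_{v_k} h_{u_i u_j}
+ h_{u_k} h_{v_i v_j}`. -/
noncomputable def firstExpr (K : Type*) [Field K] (i j k : Fin 3) : MvPolynomial (JetCoord 2) K :=
  (X (c1 0 (u k)) - X (c1 1 (v k))) * X (c2 0 (u i) (u j))
    + X (c1 1 (u k)) * (X (c2 0 (u i) (v j)) + X (c2 0 (u j) (v i)))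
    + X (c1 0 (v k)) * X (c2 1 (u i) (u j))
    + X (c1 1 (u k)) * X (c2 1 (v i) (v j))

/-- The unsymmetrised expression
`(h_{v_k} - f_{u_k}) h_{v_i v_j} + f_{v_k} (h_{u_i v_j} + h_{u_j v_i}) + h_{u_k} f_{v_i v_j}
+ f_{v_k} f_{u_i u_j}`. -/
noncomputable def secondExpr (K : Type*) [Field K] (i j k : Fin 3) : MvPolynomial (JetCoord 2) K :=
  (X (c1 1 (v k)) - X (c1 0 (u k))) * X (c2 1 (v i) (v j))
    + X (c1 0 (v k)) * (X (c2 1 (u i) (v j)) + X (c2 1 (u j) (v i)))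
    + X (c1 1 (u k)) * X (c2 0 (v i) (v j))
    + X (c1 0 (v k)) * X (c2 0 (u i) (u j))

/-- Complete symmetrisation over three indices (up to the factor `1/6`). -/
def symmetrise {M : Type*} [AddCommMonoid M] (F : Fin 3 → Fin 3 → Fin 3 → M)
    (t : Fin 3 → Fin 3) : M :=
  ∑ π : Equiv.Perm (Fin 3), F (t (π 0)) (t (π 1)) (t (π 2))

/-- The left-hand sides of the conditions of linear degeneracy, indexed by the family (`0` or `1`)
and by the triple `t = (i, j, k)`. Triples that differ by a permutation give the same polynomial,
so these are `10 + 10` conditions. -/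
noncomputable def linDegEq (K : Type*) [Field K] (l : Fin 2) (t : Fin 3 → Fin 3) :
    MvPolynomial (JetCoord 2) K :=
  if l = 0 then symmetrise (firstExpr K) t else symmetrise (secondExpr K) t

/-- The first prolongation in `J³` of the conditions of linear degeneracy: the conditions
themselves together with all their first total derivatives. -/
def prolongation (K : Type*) [Field K] : Set (Jet K 3) :=
  {q | ∀ (l : Fin 2) (t : Fin 3 → Fin 3),
    eval (proj q) (linDegEq K l t) = 0 ∧ ∀ a : Base, totalDeriv a (linDegEq K l t) q = 0}

/-! ### Non-degeneracy -/

/-- For the system `F = u₄ - f = 0`, `H = v₄ - h = 0`, the symmetric matrix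
`g^{ij} = (F_{u_i} H_{v_j} + F_{u_j} H_{v_i} - F_{v_i} H_{u_j} - F_{v_j} H_{u_i}) / 2` of the quadric
`det (∑ p_i [[F_{u_i}, F_{v_i}], [H_{u_i}, H_{v_i}]]) = 0`, at a jet `p`. -/
def charMatrix {K : Type*} [Field K] (p : Jet K 2) : Matrix (Fin 4) (Fin 4) K :=
  let Fu : Fin 4 → K := Fin.snoc (fun i : Fin 3 => -p (c1 0 (u i))) 1
  let Fv : Fin 4 → K := Fin.snoc (fun i : Fin 3 => -p (c1 0 (v i))) 0
  let Hu : Fin 4 → K := Fin.snoc (fun i : Fin 3 => -p (c1 1 (u i))) 0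
  let Hv : Fin 4 → K := Fin.snoc (fun i : Fin 3 => -p (c1 1 (v i))) 1
  Matrix.of fun i j => (Fu i * Hv j + Fu j * Hv i - Fv i * Hu j - Fv j * Hu i) / 2

/-- The open set of 2-jets with non-degenerate characteristic quadric. -/
def nondegenerate (K : Type*) [Field K] : Set (Jet K 2) := {p | (charMatrix p).det ≠ 0}

/-- The second-order locus: the non-degenerate 2-jets that lift to the first prolongation of the
conditions of linear degeneracy. -/
def secondOrderLocus (K : Type*) [Field K] : Set (Jet K 2) :=
  proj '' prolongation K ∩ nondegenerate K

end LinDeg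

namespace LinDeg

open MvPolynomial

/-! ### Zariski closed and irreducible sets -/

section Zariski

variable {σ K : Type*} [Field K]

theorem isClosed_zariski_iff {Z : Set (σ → K)} :
    @IsClosed (σ → K) (zariski σ K) Z ↔
      ∃ I : Ideal (MvPolynomial σ K), Z = zeroLocus K I := by
  let _ := zariski σ K
  rw [← isOpen_compl_iff]
  change Zᶜᶜ ∈ _ ↔ _
  rw [compl_compl]
  rfl

theorem isClosed_zariski_setOf_eval_eq_zero {ι : Type*} (p : ι → MvPolynomial σ K) :
    @IsClosed (σ → K) (zariski σ K) {x | ∀ i, eval x (p i) = 0} := by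
  rw [isClosed_zariski_iff]
  refine ⟨Ideal.span (Set.range p), ?_⟩
  rw [zeroLocus_span]
  ext x
  simp [aeval_eq_eval]

theorem isIrred_of_isPrime_vanishingIdeal {S : Set (σ → K)} (hS : S.Nonempty)
    (h : (vanishingIdeal K S).IsPrime) : IsIrred S := by
  let _ := zariski σ K
  refine ⟨hS, isPreirreducible_iff_isClosed_union_isClosed.2 ?_⟩
  intro Z₁ Z₂ h₁ h₂ hZ
  obtain ⟨I₁, rfl⟩ := isClosed_zariski_iff.1 h₁
  obtain ⟨I₂, rfl⟩ := isClosed_zariski_iff.1 h₂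
  have hle : I₁ * I₂ ≤ vanishingIdeal K S := by
    rw [Ideal.mul_le]
    intro p hp q hq x hx
    rw [map_mul]
    rcases hZ hx with hx | hx
    · rw [hx p hp, zero_mul]
    · rw [hx q hq, mul_zero]
  exact (h.mul_le.1 hle).imp (fun h => le_zeroLocus_iff_le_vanishingIdeal.2 h)
    (fun h => le_zeroLocus_iff_le_vanishingIdeal.2 h)

theorem IsClosedIn.inter {U S T : Set (σ → K)} (hS : IsClosedIn U S) (hT : IsClosedIn U T) :
    IsClosedIn U (S ∩ T) := by
  let _ := zariski σ K
  obtain ⟨Z, hZ, rfl⟩ := hS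
  obtain ⟨Y, hY, rfl⟩ := hT
  exact ⟨Z ∩ Y, hZ.inter hY, (Set.inter_inter_distrib_right Z Y U).symm⟩

/-- The irreducible components of the union of two incomparable irreducible closed sets. -/
theorem components_union {U S T : Set (σ → K)} (hS : IsClosedIn U S) (hT : IsClosedIn U T)
    (hSi : IsIrred S) (hTi : IsIrred T) (hST : ¬ S ⊆ T) (hTS : ¬ T ⊆ S) :
    components (S ∪ T) = {S, T} := by
  let _ := zariski σ K
  have key : ∀ R : Set (σ → K), R ⊆ S ∪ T → IsIrred R → R ⊆ S ∨ R ⊆ T := by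
    intro R hR hRi
    obtain ⟨Z, hZ, rfl⟩ := hS
    obtain ⟨Y, hY, rfl⟩ := hT
    have hRU : R ⊆ U := fun x hx => (hR hx).elim And.right And.right
    have := isPreirreducible_iff_isClosed_union_isClosed.1 hRi.2 Z Y hZ hY
      (fun x hx => (hR hx).imp And.left And.left)
    exact this.imp (fun h => Set.subset_inter h hRU) (fun h => Set.subset_inter h hRU)
  ext R
  simp only [components, Set.mem_ofPred_eq, Set.mem_insert_iff, Set.mem_singleton_iff]
  constructor
  · rintro ⟨⟨hR, hRi⟩, hmax⟩
    rcases key R hR hRi with h | h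
    · exact Or.inl (h.antisymm (hmax ⟨Set.subset_union_left, hSi⟩ h))
    · exact Or.inr (h.antisymm (hmax ⟨Set.subset_union_right, hTi⟩ h))
  · rintro (rfl | rfl)
    · refine ⟨⟨Set.subset_union_left, hSi⟩, fun Q hQ hRQ => ?_⟩
      exact (key Q hQ.1 hQ.2).resolve_right fun h => hST (hRQ.trans h)
    · refine ⟨⟨Set.subset_union_right, hTi⟩, fun Q hQ hRQ => ?_⟩
      exact (key Q hQ.1 hQ.2).resolve_left fun h => hTS (hRQ.trans h)

end Zariski

/-! ### Images of affine subspaces under birational maps of an affine space -/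

/-- A polynomial self-map of the affine space `σ → K` that restricts to a bijection of the principal
open set `den ≠ 0` onto itself, the inverse being given by the rational functions `inv i / den`. -/
structure PolyChart (σ K : Type*) [Field K] where
  toPoly : σ → MvPolynomial σ K
  inv : σ → MvPolynomial σ K
  den : MvPolynomial σ K
  map_den : ∀ x, eval x den ≠ 0 → eval (fun i => eval x (toPoly i)) den ≠ 0
  surj : ∀ y, eval y den ≠ 0 → ∃ x, eval x den ≠ 0 ∧ (fun i => eval x (toPoly i)) = y
  eval_inv : ∀ x, eval x den ≠ 0 → ∀ i, eval (fun i => eval x (toPoly i)) (inv i) =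
    eval (fun i => eval x (toPoly i)) den * x i

namespace PolyChart

variable {σ K : Type*} [Field K] (Φ : PolyChart σ K)

/-- The principal open set of a chart. -/
def dom : Set (σ → K) := {x | eval x Φ.den ≠ 0}

/-- The map of a chart. -/
noncomputable def map (x : σ → K) : σ → K := fun i => eval x (Φ.toPoly i)

theorem injOn_map : Set.InjOn Φ.map Φ.dom := by
  intro x hx y hy hxy
  funext i
  have h1 := Φ.eval_inv x hx i
  have h2 := Φ.eval_inv y hy i
  change eval (Φ.map x) _ = eval (Φ.map x) _ * _ at h1
  change eval (Φ.map y) _ = eval (Φ.map y) _ * _ at h2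
  rw [← hxy, h1] at h2
  exact mul_left_cancel₀ (Φ.map_den x hx) h2

/-- The image of the affine subspace `x₀ + L`. -/
def image (x₀ : σ → K) (L : Submodule K (σ → K)) : Set (σ → K) :=
  Φ.map '' {x | x ∈ Φ.dom ∧ x - x₀ ∈ L}

theorem image_mono (x₀ : σ → K) {L L' : Submodule K (σ → K)} (h : L ≤ L') :
    Φ.image x₀ L ⊆ Φ.image x₀ L' :=
  Set.image_mono fun _ hx => ⟨hx.1, h hx.2⟩

theorem image_inf (x₀ : σ → K) (L L' : Submodule K (σ → K)) :
    Φ.image x₀ (L ⊓ L') = Φ.image x₀ L ∩ Φ.image x₀ L' := by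
  rw [image, image, image, ← Set.InjOn.image_inter Φ.injOn_map (fun _ h => h.1) (fun _ h => h.1)]
  congr 1
  ext x
  simp only [Set.mem_ofPred_eq, Set.mem_inter_iff, Submodule.mem_inf]
  tauto

theorem exists_add_smul_mem_dom [Infinite K] {x₀ : σ → K} (h₀ : x₀ ∈ Φ.dom) (w : σ → K) :
    ∃ c : K, c ≠ 0 ∧ x₀ + c • w ∈ Φ.dom := by
  let P : Polynomial K :=
    aeval (fun i => Polynomial.C (x₀ i) + Polynomial.C (w i) * Polynomial.X) Φ.den
  have hP : ∀ c, P.eval c = eval (x₀ + c • w) Φ.den := by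
    intro c
    have : (Polynomial.aeval c).comp
        (aeval (fun i => Polynomial.C (x₀ i) + Polynomial.C (w i) * Polynomial.X)) =
        aeval (R := K) (x₀ + c • w) := by
      ext i
      simp only [AlgHom.comp_apply, aeval_X, map_add, map_mul, Polynomial.aeval_C,
        Polynomial.aeval_X, Pi.add_apply, Pi.smul_apply, smul_eq_mul, mul_comm c]
      rfl
    have h2 := congrArg (fun f => f Φ.den) this
    rw [aeval_eq_eval] at h2
    rw [← Polynomial.coe_aeval_eq_eval]
    exact h2
  have hP0 : P * Polynomial.X ≠ 0 := by
    refine mul_ne_zero (fun h => h₀ ?_) Polynomial.X_ne_zero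
    have := hP 0
    rw [h] at this
    simpa using this.symm
  obtain ⟨c, hc⟩ : ∃ c, (P * Polynomial.X).eval c ≠ 0 := by
    by_contra! h
    exact hP0 (Polynomial.funext fun r => by simpa using h r)
  rw [Polynomial.eval_mul, Polynomial.eval_X, hP] at hc
  exact ⟨c, right_ne_zero_of_mul hc, left_ne_zero_of_mul hc⟩

variable [Fintype σ]

/-- The function `y ↦ den y * (φ (map⁻¹ y) - φ x₀)` as a polynomial. -/
noncomputable def pullback (x₀ : σ → K) (φ : (σ → K) →ₗ[K] K) : MvPolynomial σ K :=
  open Classical in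
  (∑ i, C (φ (Pi.single i 1)) * Φ.inv i) - C (φ x₀) * Φ.den

theorem eval_pullback (x₀ : σ → K) (φ : (σ → K) →ₗ[K] K) {x : σ → K} (hx : x ∈ Φ.dom) :
    eval (Φ.map x) (Φ.pullback x₀ φ) = eval (Φ.map x) Φ.den * φ (x - x₀) := by
  classical
  have h : ∀ i, eval (Φ.map x) (Φ.inv i) = eval (Φ.map x) Φ.den * x i := Φ.eval_inv x hx
  have hφ : φ x = ∑ i, φ (Pi.single i 1) * x i := by
    conv_lhs => rw [pi_eq_sum_univ' x, map_sum]
    refine Finset.sum_congr rfl fun i _ => ?_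
    rw [map_smul, smul_eq_mul, mul_comm]
  simp only [pullback, map_sub, map_sum, map_mul, eval_C, h, hφ, mul_sub, Finset.mul_sum]
  congr 1
  · exact Finset.sum_congr rfl fun i _ => by ring
  · ring

theorem isClosedIn_image (x₀ : σ → K) (L : Submodule K (σ → K)) :
    IsClosedIn Φ.dom (Φ.image x₀ L) := by
  refine ⟨_, isClosed_zariski_setOf_eval_eq_zero
    (fun φ : {φ : (σ → K) →ₗ[K] K // L ≤ LinearMap.ker φ} => Φ.pullback x₀ φ.1), ?_⟩
  ext y
  constructor
  · rintro ⟨x, ⟨hx, hxL⟩, rfl⟩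
    refine ⟨fun φ => ?_, Φ.map_den x hx⟩
    rw [Φ.eval_pullback x₀ φ.1 hx, LinearMap.mem_ker.1 (φ.2 hxL), mul_zero]
  · rintro ⟨hy, hyU⟩
    obtain ⟨x, hx, rfl⟩ := Φ.surj y hyU
    refine ⟨x, ⟨hx, ?_⟩, rfl⟩
    by_contra hxL
    obtain ⟨φ, hφ, hL⟩ := Submodule.exists_le_ker_of_notMem hxL
    have h0 := hy ⟨φ, hL⟩
    change eval (Φ.map x) _ = 0 at h0
    rw [Φ.eval_pullback x₀ φ hx] at h0
    exact mul_ne_zero hyU hφ h0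

variable [Infinite K]

theorem isPrime_vanishingIdeal_image {x₀ : σ → K} (h₀ : x₀ ∈ Φ.dom) (L : Submodule K (σ → K)) :
    (vanishingIdeal K (Φ.image x₀ L)).IsPrime := by
  let b := Module.finBasis K L
  let α : MvPolynomial σ K →ₐ[K] MvPolynomial (Fin (Module.finrank K L)) K :=
    aeval fun i => C (x₀ i) + ∑ j, C ((b j : σ → K) i) * X j
  let θ : MvPolynomial σ K →ₐ[K] MvPolynomial (Fin (Module.finrank K L)) K :=
    α.comp (aeval Φ.toPoly)
  let pt : (Fin (Module.finrank K L) → K) → σ → K := fun c => x₀ + ∑ j, c j • (b j : σ → K)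
  have hα : ∀ c p, eval c (α p) = eval (pt c) p := by
    intro c p
    have : (aeval c).comp α = aeval (pt c) := by
      ext i
      simp [α, pt, aeval_eq_eval, mul_comm]
    simpa [aeval_eq_eval] using congrArg (fun f => f p) this
  have hθ : ∀ c p, eval c (θ p) = eval (Φ.map (pt c)) p := by
    intro c p
    have : (aeval (pt c)).comp (aeval Φ.toPoly) = aeval (R := K) (Φ.map (pt c)) := by
      ext i
      simp [aeval_eq_eval, map]
    have h2 := congrArg (fun f => f p) this
    simp only [AlgHom.comp_apply] at h2
    rw [aeval_eq_eval, aeval_eq_eval] at h2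
    rw [show θ p = α (aeval Φ.toPoly p) from rfl, hα]
    exact h2
  have hD : α Φ.den ≠ 0 := by
    intro h
    have h1 := hα 0 Φ.den
    rw [h, map_zero] at h1
    apply h₀
    simpa [pt] using h1.symm
  have hker : vanishingIdeal K (Φ.image x₀ L) = RingHom.ker θ := by
    ext p
    rw [mem_vanishingIdeal_iff, RingHom.mem_ker]
    constructor
    · intro hp
      have : α Φ.den * θ p = 0 := by
        refine MvPolynomial.funext fun c => ?_
        rw [map_mul, map_zero]
        by_cases hc : pt c ∈ Φ.dom
        · rw [hθ]
          have := hp (Φ.map (pt c)) ⟨pt c, ⟨hc, ?_⟩, rfl⟩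
          · rw [aeval_eq_eval] at this
            rw [show eval (Φ.map (pt c)) p = 0 from this, mul_zero]
          · simp only [pt, add_sub_cancel_left]
            exact L.sum_mem fun j _ => L.smul_mem _ (b j).2
        · have : eval (pt c) Φ.den = 0 := not_not.1 hc
          rw [hα, this, zero_mul]
      exact (mul_eq_zero.1 this).resolve_left hD
    · rintro hp _ ⟨x, ⟨-, hxL⟩, rfl⟩
      let c : Fin (Module.finrank K L) → K := b.repr ⟨x - x₀, hxL⟩
      have hc : pt c = x := by
        have h1 := congrArg L.subtype (b.sum_repr ⟨x - x₀, hxL⟩)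
        simp only [map_sum, map_smul, Submodule.subtype_apply] at h1
        simp only [pt, c]
        rw [h1, add_sub_cancel]
      have := hθ c p
      rw [hc, hp, map_zero] at this
      rw [aeval_eq_eval]
      exact this.symm
  rw [hker]
  exact RingHom.ker_isPrime θ

theorem isIrred_image {x₀ : σ → K} (h₀ : x₀ ∈ Φ.dom) (L : Submodule K (σ → K)) :
    IsIrred (Φ.image x₀ L) :=
  isIrred_of_isPrime_vanishingIdeal ⟨_, x₀, ⟨h₀, by simp⟩, rfl⟩
    (Φ.isPrime_vanishingIdeal_image h₀ L)

theorem vanishingIdeal_image_lt {x₀ : σ → K} (h₀ : x₀ ∈ Φ.dom) {L L' : Submodule K (σ → K)}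
    (h : L < L') : vanishingIdeal K (Φ.image x₀ L') < vanishingIdeal K (Φ.image x₀ L) := by
  refine lt_of_le_not_ge (vanishingIdeal_anti_mono (Φ.image_mono x₀ h.le)) fun hle => ?_
  obtain ⟨w, hw, hwL⟩ := SetLike.exists_of_lt h
  obtain ⟨φ, hφ, hL⟩ := Submodule.exists_le_ker_of_notMem hwL
  obtain ⟨c, hc, hcw⟩ := Φ.exists_add_smul_mem_dom h₀ w
  have hmem : Φ.pullback x₀ φ ∈ vanishingIdeal K (Φ.image x₀ L) := by
    rintro _ ⟨x, ⟨hx, hxL⟩, rfl⟩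
    rw [aeval_eq_eval]
    rw [Φ.eval_pullback x₀ φ hx, LinearMap.mem_ker.1 (hL hxL), mul_zero]
  have h0 := hle hmem (Φ.map (x₀ + c • w))
    ⟨_, ⟨hcw, by rw [add_sub_cancel_left]; exact L'.smul_mem c hw⟩, rfl⟩
  rw [aeval_eq_eval] at h0
  change eval (Φ.map _) _ = 0 at h0
  rw [Φ.eval_pullback x₀ φ hcw, add_sub_cancel_left, map_smul, smul_eq_mul] at h0
  exact mul_ne_zero (Φ.map_den _ hcw) (mul_ne_zero hc hφ) h0

theorem le_codim_image {x₀ : σ → K} (h₀ : x₀ ∈ Φ.dom) (n : ℕ) (L : Submodule K (σ → K))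
    (h : Module.finrank K L + n = Fintype.card σ) : (n : ℕ∞) ≤ codim (Φ.image x₀ L) := by
  induction n generalizing L with
  | zero => simp
  | succ n ih =>
    have hL : L ≠ ⊤ := by
      rintro rfl
      rw [finrank_top, Module.finrank_pi] at h
      omega
    obtain ⟨w, -, hw⟩ := SetLike.exists_of_lt (lt_top_iff_ne_top.2 hL)
    have hlt : L < L ⊔ Submodule.span K {w} := by
      refine lt_of_le_of_ne le_sup_left fun h => hw ?_
      rw [h]
      exact Submodule.mem_sup_right (Submodule.mem_span_singleton_self w)
    have hfr : Module.finrank K (L ⊔ Submodule.span K {w} : Submodule K (σ → K)) =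
        Module.finrank K L + 1 := by
      have h1 := Submodule.finrank_lt_finrank_of_lt hlt
      have h2 := Submodule.finrank_add_le_finrank_add_finrank L (Submodule.span K {w})
      have h3 := finrank_span_le_card (R := K) ({w} : Set (σ → K))
      simp only [Set.toFinset_singleton, Finset.card_singleton] at h3
      omega
    have hn := ih _ (by rw [hfr]; omega)
    have := Φ.isPrime_vanishingIdeal_image h₀ L
    have := Φ.isPrime_vanishingIdeal_image h₀ (L ⊔ Submodule.span K {w})
    have h4 := Ideal.height_add_one_le_of_lt_of_isPrime (Φ.vanishingIdeal_image_lt h₀ hlt)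
    push_cast
    exact (add_le_add_left hn 1).trans h4

theorem codim_image_add_le {x₀ : σ → K} (h₀ : x₀ ∈ Φ.dom) (d : ℕ) (L : Submodule K (σ → K))
    (h : Module.finrank K L = d) : codim (Φ.image x₀ L) + d ≤ Fintype.card σ := by
  induction d generalizing L with
  | zero =>
    have := Φ.isPrime_vanishingIdeal_image h₀ L
    have h1 := Ideal.height_le_ringKrullDim_of_isPrime (I := vanishingIdeal K (Φ.image x₀ L))
    rw [MvPolynomial.ringKrullDim_of_isNoetherianRing, ringKrullDim_eq_zero_of_field, zero_add,
      Nat.card_eq_fintype_card] at h1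
    simp only [Nat.cast_zero, add_zero]
    exact_mod_cast h1
  | succ d ih =>
    have hL : L ≠ ⊥ := by
      rintro rfl
      simp at h
    obtain ⟨w, hw, hw0⟩ := L.ne_bot_iff.1 hL
    obtain ⟨N, hN⟩ := (Submodule.span K {w}).exists_isCompl
    have hwL : Submodule.span K {w} ≤ L := (Submodule.span_singleton_le_iff_mem w L).2 hw
    have hlt : N ⊓ L < L := by
      refine lt_of_le_of_ne inf_le_right fun h => hw0 ?_
      have hwN : w ∈ N ⊓ L := by rw [h]; exact hw
      exact (Submodule.disjoint_def.1 hN.disjoint) w (Submodule.mem_span_singleton_self w) hwN.1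
    have hfr : Module.finrank K (N ⊓ L : Submodule K (σ → K)) = d := by
      have h1 := Submodule.finrank_lt_finrank_of_lt hlt
      have h2 := Submodule.finrank_add_le_finrank_add_finrank (Submodule.span K {w}) (N ⊓ L)
      have h3 := finrank_span_le_card (R := K) ({w} : Set (σ → K))
      rw [← sup_inf_assoc_of_le N hwL, hN.sup_eq_top, top_inf_eq] at h2
      simp only [Set.toFinset_singleton, Finset.card_singleton] at h3
      omega
    have := Φ.isPrime_vanishingIdeal_image h₀ L
    have := Φ.isPrime_vanishingIdeal_image h₀ (N ⊓ L)
    have h4 := Ideal.height_add_one_le_of_lt_of_isPrime (Φ.vanishingIdeal_image_lt h₀ hlt)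
    calc codim (Φ.image x₀ L) + ((d + 1 : ℕ) : ℕ∞)
        = (codim (Φ.image x₀ L) + 1) + d := by push_cast; ring
      _ ≤ codim (Φ.image x₀ (N ⊓ L)) + d := add_le_add_left h4 _
      _ ≤ _ := ih _ hfr

theorem codim_image_ker {ι : Type*} [Fintype ι] {x₀ : σ → K} (h₀ : x₀ ∈ Φ.dom)
    (f : (σ → K) →ₗ[K] (ι → K)) (hf : Function.Surjective f) :
    codim (Φ.image x₀ (LinearMap.ker f)) = Fintype.card ι := by
  have h := f.finrank_range_add_finrank_ker
  rw [LinearMap.range_eq_top.2 hf, finrank_top, Module.finrank_pi, Module.finrank_pi] at h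
  refine le_antisymm ?_ (Φ.le_codim_image h₀ _ _ (by omega))
  have h1 := Φ.codim_image_add_le h₀ _ (LinearMap.ker f) rfl
  rw [← h] at h1
  push_cast at h1
  exact (ENat.add_le_add_iff_right (ENat.natCast_ne_top _)).1 h1

end PolyChart

end LinDeg

namespace LinDeg

variable {K : Type*} [Field K]

/-! ### The conditions of linear degeneracy as multilinear expressions -/

/-- The unsymmetrised conditions of linear degeneracy, with `P`, `Q`, `R` in place of the
derivatives `f_{u_k} - h_{v_k}`, `f_{v_k}`, `h_{u_k}` and `F` in place of the second derivatives. -/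
def expr (l : Fin 2) (P Q R : Fin 3 → K) (F : Fin 2 → Base → Base → K) (i j k : Fin 3) : K :=
  if l = 0 then
    P k * F 0 (u i) (u j) + R k * (F 0 (u i) (v j) + F 0 (u j) (v i)) + Q k * F 1 (u i) (u j)
      + R k * F 1 (v i) (v j)
  else
    -P k * F 1 (v i) (v j) + Q k * (F 1 (u i) (v j) + F 1 (u j) (v i)) + R k * F 0 (v i) (v j)
      + Q k * F 0 (u i) (u j)

/-- The symmetrisation of `expr`, up to a factor. -/
def symExpr (l : Fin 2) (P Q R : Fin 3 → K) (F : Fin 2 → Base → Base → K) (i j k : Fin 3) : K :=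
  expr l P Q R F i j k + expr l P Q R F j k i + expr l P Q R F k i j

/-- The symmetrised conditions for the standard coefficients `P = -e₁`, `Q = e₀`, `R = -e₂`. -/
def stdExpr (l : Fin 2) (F : Fin 2 → Base → Base → K) (i j k : Fin 3) : K :=
  symExpr l ![0, -1, 0] ![1, 0, 0] ![0, 0, -1] F i j k

/-- The part of the total derivative along `a` of the symmetrised conditions that is quadratic in
the second derivatives. -/
def quadExpr (F : Fin 2 → Base → Base → K) (l : Fin 2) (i j k : Fin 3) (a : Base) : K :=
  symExpr l (fun n => F 0 a (u n) - F 1 a (v n)) (fun n => F 0 a (v n)) (fun n => F 1 a (u n))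
    F i j k

theorem expr_swap (l : Fin 2) (P Q R : Fin 3 → K) {F : Fin 2 → Base → Base → K}
    (hF : ∀ m a b, F m a b = F m b a) (i j k : Fin 3) :
    expr l P Q R F i j k = expr l P Q R F j i k := by
  simp only [expr, hF 0 (u j) (u i), hF 1 (u j) (u i), hF 0 (v j) (v i), hF 1 (v j) (v i),
    add_comm (F _ (u j) (v i))]

theorem symExpr_swap (l : Fin 2) (P Q R : Fin 3 → K) {F : Fin 2 → Base → Base → K}
    (hF : ∀ m a b, F m a b = F m b a) (i j k : Fin 3) :
    symExpr l P Q R F i j k = symExpr l P Q R F j i k := by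
  rw [symExpr, symExpr, expr_swap l P Q R hF i j k, expr_swap l P Q R hF j k i,
    expr_swap l P Q R hF k i j]
  ring

theorem symExpr_rotate (l : Fin 2) (P Q R : Fin 3 → K) (F : Fin 2 → Base → Base → K)
    (i j k : Fin 3) : symExpr l P Q R F i j k = symExpr l P Q R F j k i := by
  rw [symExpr, symExpr]
  ring

/-- A symmetric property of triples of indices needs to be checked for ordered triples only. -/
theorem forall_of_ordered {p : Fin 3 → Fin 3 → Fin 3 → Prop}
    (hs : ∀ i j k, p i j k → p j i k) (hr : ∀ i j k, p i j k → p j k i)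
    (h₀₀₀ : p 0 0 0) (h₀₀₁ : p 0 0 1) (h₀₀₂ : p 0 0 2) (h₀₁₁ : p 0 1 1) (h₀₁₂ : p 0 1 2)
    (h₀₂₂ : p 0 2 2) (h₁₁₁ : p 1 1 1) (h₁₁₂ : p 1 1 2) (h₁₂₂ : p 1 2 2) (h₂₂₂ : p 2 2 2)
    (i j k : Fin 3) : p i j k := by
  have h (i j k : Fin 3) (hij : i ≤ j) (hjk : j ≤ k) : p i j k := by
    fin_cases i <;> fin_cases j <;> fin_cases k <;>
      first | assumption | exact absurd hij (by decide) | exact absurd hjk (by decide)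
  rcases le_total i j with h1 | h1 <;> rcases le_total j k with h2 | h2 <;>
    rcases le_total i k with h3 | h3
  · exact h _ _ _ h1 h2
  · exact h _ _ _ h1 h2
  · exact hr _ _ _ (hs _ _ _ (h _ _ _ h3 h2))
  · exact hr _ _ _ (h _ _ _ h3 h1)
  · exact hs _ _ _ (h _ _ _ h1 h3)
  · exact hr _ _ _ (hr _ _ _ (h _ _ _ h2 h3))
  · exact hr _ _ _ (hr _ _ _ (hs _ _ _ (h _ _ _ h2 h1)))
  · exact hr _ _ _ (hr _ _ _ (hs _ _ _ (h _ _ _ h2 h1)))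

section

variable (F : Fin 2 → Base → Base → K)

theorem stdExpr_zero_000 : stdExpr 0 F 0 0 0 = 3 * F 1 (u 0) (u 0) := by
  simp [stdExpr, symExpr, expr]
  try ring

theorem stdExpr_zero_001 : stdExpr 0 F 0 0 1 = -F 0 (u 0) (u 0) + F 1 (u 0) (u 1)
    + F 1 (u 1) (u 0) := by
  simp [stdExpr, symExpr, expr]
  try ring

theorem stdExpr_zero_002 : stdExpr 0 F 0 0 2 = -2 * F 0 (u 0) (v 0) - F 1 (v 0) (v 0)
    + F 1 (u 0) (u 2)
    + F 1 (u 2) (u 0) := by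
  simp [stdExpr, symExpr, expr]
  try ring

theorem stdExpr_zero_011 : stdExpr 0 F 0 1 1 = -F 0 (u 0) (u 1) + F 1 (u 1) (u 1)
    - F 0 (u 1) (u 0) := by
  simp [stdExpr, symExpr, expr]
  try ring

theorem stdExpr_zero_012 : stdExpr 0 F 0 1 2 = -F 0 (u 0) (v 1) - F 0 (u 1) (v 0) - F 1 (v 0) (v 1)
    + F 1 (u 1) (u 2) - F 0 (u 2) (u 0) := by
  simp [stdExpr, symExpr, expr]
  try ring

theorem stdExpr_zero_022 : stdExpr 0 F 0 2 2 = -2 * F 0 (u 0) (v 2) - 2 * F 0 (u 2) (v 0)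
    - F 1 (v 0) (v 2)
    + F 1 (u 2) (u 2) - F 1 (v 2) (v 0) := by
  simp [stdExpr, symExpr, expr]
  try ring

theorem stdExpr_zero_111 : stdExpr 0 F 1 1 1 = -3 * F 0 (u 1) (u 1) := by
  simp [stdExpr, symExpr, expr]
  try ring

theorem stdExpr_zero_112 : stdExpr 0 F 1 1 2 = -2 * F 0 (u 1) (v 1) - F 1 (v 1) (v 1)
    - F 0 (u 1) (u 2)
    - F 0 (u 2) (u 1) := by
  simp [stdExpr, symExpr, expr]
  try ring

theorem stdExpr_zero_122 : stdExpr 0 F 1 2 2 = -2 * F 0 (u 1) (v 2) - 2 * F 0 (u 2) (v 1)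
    - F 1 (v 1) (v 2)
    - F 0 (u 2) (u 2) - F 1 (v 2) (v 1) := by
  simp [stdExpr, symExpr, expr]
  try ring

theorem stdExpr_zero_222 : stdExpr 0 F 2 2 2 = -6 * F 0 (u 2) (v 2) - 3 * F 1 (v 2) (v 2) := by
  simp [stdExpr, symExpr, expr]
  try ring

theorem stdExpr_one_000 : stdExpr 1 F 0 0 0 = 6 * F 1 (u 0) (v 0) + 3 * F 0 (u 0) (u 0) := by
  simp [stdExpr, symExpr, expr]
  try ring

theorem stdExpr_one_001 : stdExpr 1 F 0 0 1 = F 1 (v 0) (v 0) + 2 * F 1 (u 0) (v 1)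
    + 2 * F 1 (u 1) (v 0)
    + F 0 (u 0) (u 1) + F 0 (u 1) (u 0) := by
  simp [stdExpr, symExpr, expr]
  try ring

theorem stdExpr_one_002 : stdExpr 1 F 0 0 2 = -F 0 (v 0) (v 0) + 2 * F 1 (u 0) (v 2)
    + 2 * F 1 (u 2) (v 0)
    + F 0 (u 0) (u 2) + F 0 (u 2) (u 0) := by
  simp [stdExpr, symExpr, expr]
  try ring

theorem stdExpr_one_011 : stdExpr 1 F 0 1 1 = F 1 (v 0) (v 1) + 2 * F 1 (u 1) (v 1)
    + F 0 (u 1) (u 1)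
    + F 1 (v 1) (v 0) := by
  simp [stdExpr, symExpr, expr]
  try ring

theorem stdExpr_one_012 : stdExpr 1 F 0 1 2 = -F 0 (v 0) (v 1) + F 1 (u 1) (v 2) + F 1 (u 2) (v 1)
    + F 0 (u 1) (u 2) + F 1 (v 2) (v 0) := by
  simp [stdExpr, symExpr, expr]
  try ring

theorem stdExpr_one_022 : stdExpr 1 F 0 2 2 = -F 0 (v 0) (v 2) + 2 * F 1 (u 2) (v 2)
    + F 0 (u 2) (u 2)
    - F 0 (v 2) (v 0) := by
  simp [stdExpr, symExpr, expr]
  try ring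

theorem stdExpr_one_111 : stdExpr 1 F 1 1 1 = 3 * F 1 (v 1) (v 1) := by
  simp [stdExpr, symExpr, expr]
  try ring

theorem stdExpr_one_112 : stdExpr 1 F 1 1 2 = -F 0 (v 1) (v 1) + F 1 (v 1) (v 2)
    + F 1 (v 2) (v 1) := by
  simp [stdExpr, symExpr, expr]
  try ring

theorem stdExpr_one_122 : stdExpr 1 F 1 2 2 = -F 0 (v 1) (v 2) + F 1 (v 2) (v 2)
    - F 0 (v 2) (v 1) := by
  simp [stdExpr, symExpr, expr]
  try ring

theorem stdExpr_one_222 : stdExpr 1 F 2 2 2 = -3 * F 0 (v 2) (v 2) := by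
  simp [stdExpr, symExpr, expr]
  try ring

end

/-- Generators of the linear relations between the values `stdExpr l (T a) i j k` of a symmetric
tensor `T`. -/
def compat (r : Fin 2 → Fin 3 → Fin 3 → Fin 3 → Base → K) : Fin 25 → K :=
  ![3 * r 1 0 1 1 (v 1) + r 0 1 1 1 (v 1) - 2 * r 1 1 1 1 (u 1) - 2 * r 1 1 1 1 (v 0),
    3 * r 0 1 1 2 (u 1) - 2 * r 0 1 1 1 (v 1) + r 1 1 1 1 (u 1) - 2 * r 0 1 1 1 (u 2),
    r 1 0 0 0 (u 0) - 2 * r 0 0 0 0 (v 0) + 3 * r 0 0 0 1 (u 0) - 2 * r 0 0 0 0 (u 1),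
    r 0 2 2 2 (v 2) - 2 * r 1 2 2 2 (u 2) + 3 * r 1 1 2 2 (v 2) - 2 * r 1 2 2 2 (v 1),
    3 * r 1 0 1 1 (u 0) + r 0 1 1 1 (u 0) - 3 * r 0 0 0 1 (v 1) - r 1 0 0 0 (v 1),
    3 * r 0 1 1 2 (v 2) + r 1 1 1 1 (v 2) - 3 * r 1 1 2 2 (u 1) - r 0 2 2 2 (u 1),
    6 * r 0 1 2 2 (v 2) - 4 * r 1 2 2 2 (u 1) - r 0 2 2 2 (v 1) - r 0 2 2 2 (u 2)
        - 3 * r 1 1 2 2 (u 2)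
      - 3 * r 1 1 2 2 (v 1) + 6 * r 1 1 1 2 (v 2),
    6 * r 1 0 2 2 (v 2) - 4 * r 1 2 2 2 (v 0) - 9 * r 1 1 2 2 (u 2) + r 0 2 2 2 (u 2)
        - 3 * r 1 1 2 2 (v 1)
      + 6 * r 1 1 1 2 (v 2) + 3 * r 0 2 2 2 (v 1),
    9 * r 0 0 0 1 (v 0) - 3 * r 1 0 0 0 (u 1) + 3 * r 0 0 0 1 (u 1) - 6 * r 0 0 1 1 (u 0)
        - 6 * r 0 0 0 2 (u 0)
      + 4 * r 0 0 0 0 (u 2) - r 1 0 0 0 (v 0),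
    9 * r 1 0 0 1 (u 0) - 6 * r 0 0 0 0 (v 1) - 3 * r 1 0 0 0 (u 1) - 2 * r 1 0 0 0 (v 0)
        - 3 * r 0 0 0 1 (u 1)
      + 6 * r 0 0 1 1 (u 0) - 3 * r 0 0 0 2 (u 0) + 2 * r 0 0 0 0 (u 2),
    3 * r 0 1 2 2 (u 2) + 3 * r 1 0 2 2 (u 2) + r 0 2 2 2 (v 0) - 6 * r 0 0 2 2 (v 2)
        + 4 * r 1 2 2 2 (u 0)
      + 6 * r 1 0 2 2 (v 1) - 3 * r 1 1 2 2 (v 0) - 6 * r 1 0 1 2 (v 2) - 2 * r 0 2 2 2 (u 1),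
    3 * r 0 1 2 2 (v 1) + 2 * r 1 1 1 1 (v 2) - 6 * r 1 1 1 2 (u 2) - 3 * r 1 1 2 2 (u 1)
        + r 0 2 2 2 (u 1)
      + 3 * r 1 0 2 2 (v 1) - 6 * r 1 1 2 2 (v 0) + 6 * r 1 0 1 2 (v 2),
    3 * r 0 0 0 2 (v 0) + r 1 0 0 0 (u 2) + 3 * r 1 0 0 1 (v 0) - 6 * r 1 0 0 2 (u 0)
        + 4 * r 0 0 0 0 (v 2)
      + 6 * r 0 0 0 2 (u 1) - 3 * r 0 0 0 1 (u 2) - 6 * r 0 0 1 2 (u 0) - 2 * r 1 0 0 0 (v 1),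
    3 * r 1 0 0 1 (u 1) + 2 * r 0 1 1 1 (u 0) - 6 * r 0 0 1 1 (v 0) - 3 * r 0 0 0 1 (v 1)
        + r 1 0 0 0 (v 1)
      + 6 * r 0 0 1 2 (u 0) - 6 * r 0 0 0 1 (u 2) + 3 * r 0 0 0 2 (u 1),
    6 * r 0 0 1 2 (u 2) - 6 * r 0 0 2 2 (u 1) + 3 * r 0 1 1 2 (v 0) + r 1 1 1 1 (v 0)
        + 3 * r 1 0 2 2 (u 0)
      - 3 * r 0 0 0 2 (v 2) + 3 * r 1 0 1 1 (u 2) - r 0 1 1 1 (u 2) - 3 * r 0 1 2 2 (u 0)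
          - 3 * r 1 0 0 1 (v 2)
      - 6 * r 1 0 1 2 (u 1) + 6 * r 0 0 1 1 (v 2),
    6 * r 0 0 1 2 (v 1) + 2 * r 1 1 1 1 (v 0) - 6 * r 1 1 1 2 (u 0) + 3 * r 1 0 0 1 (v 2)
        - 3 * r 0 1 2 2 (u 0)
      - 3 * r 1 0 2 2 (u 0) + 3 * r 0 0 0 2 (v 2) - 6 * r 1 0 1 2 (u 1) - 2 * r 0 1 1 1 (u 2)
          + 6 * r 0 0 1 1 (v 2),
    6 * r 1 0 1 2 (v 0) - 6 * r 1 0 0 2 (v 1) + 3 * r 0 1 1 2 (v 0) + r 1 1 1 1 (v 0)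
        + 3 * r 1 0 1 1 (u 2)
      - r 0 1 1 1 (u 2) - 6 * r 0 1 2 2 (u 0) - 6 * r 1 0 2 2 (u 0) + 6 * r 0 0 0 2 (v 2)
          - 6 * r 1 0 1 2 (u 1)
      + 6 * r 0 0 1 1 (v 2),
    6 * r 0 0 1 2 (u 1) - r 0 1 1 1 (v 0) - 6 * r 0 0 1 1 (u 2) + 3 * r 1 0 1 1 (v 0)
        - 3 * r 0 1 1 2 (u 0)
      - r 1 1 1 1 (u 0) - 12 * r 1 0 1 2 (u 0) + 6 * r 0 0 0 2 (v 1) + 6 * r 0 0 0 1 (v 2)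
          + 2 * r 1 0 0 0 (v 2),
    2 * r 0 0 1 2 (v 0) - 2 * r 1 0 0 2 (u 1) - 2 * r 0 0 0 2 (v 1) + r 0 0 0 1 (v 2)
        - r 1 0 0 0 (v 2)
      + r 1 0 0 1 (u 2) + r 0 0 0 2 (u 2) - 2 * r 0 0 2 2 (u 0) + 2 * r 1 0 1 2 (u 0),
    3 * r 1 0 0 1 (v 1) - r 1 1 1 1 (u 0) - 3 * r 1 0 1 1 (v 0) - r 0 1 1 1 (v 0)
        + 3 * r 0 1 1 2 (u 0)
      + 6 * r 1 0 1 2 (u 0) - 3 * r 0 0 0 2 (v 1) - 3 * r 0 0 0 1 (v 2) - r 1 0 0 0 (v 2),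
    3 * r 1 0 1 1 (u 1) + r 0 1 1 1 (u 1) - 6 * r 0 0 1 1 (v 1) - 3 * r 1 0 1 1 (v 0)
        - r 0 1 1 1 (v 0)
      + 6 * r 0 1 1 2 (u 0) + 2 * r 1 1 1 1 (u 0) + 12 * r 1 0 1 2 (u 0) - 6 * r 0 0 0 2 (v 1)
          - 6 * r 0 0 0 1 (v 2)
      - 2 * r 1 0 0 0 (v 2),
    3 * r 0 1 1 2 (v 1) + r 1 1 1 1 (v 1) - 6 * r 1 1 1 2 (u 1) - 3 * r 0 1 1 2 (u 2)
        - r 1 1 1 1 (u 2)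
      + 6 * r 1 0 1 1 (v 2) + 2 * r 0 1 1 1 (v 2) + 12 * r 0 0 1 2 (v 2) - 6 * r 1 1 2 2 (u 0)
          - 2 * r 0 2 2 2 (u 0)
      - 6 * r 1 0 2 2 (u 1),
    3 * r 0 1 2 2 (u 1) - r 0 1 1 1 (v 2) - 3 * r 0 1 1 2 (u 2) - r 1 1 1 1 (u 2)
        + 3 * r 1 0 1 1 (v 2)
      + 6 * r 0 0 1 2 (v 2) - 3 * r 1 1 2 2 (u 0) - r 0 2 2 2 (u 0) - 3 * r 1 0 2 2 (u 1),
    r 0 1 2 2 (v 0) + r 1 0 2 2 (v 0) - 2 * r 1 0 2 2 (u 1) + 2 * r 1 0 1 2 (u 2)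
        - 2 * r 0 0 2 2 (v 1)
      + r 1 1 2 2 (u 0) - 2 * r 1 0 0 2 (v 2) - r 0 2 2 2 (u 0) + 2 * r 0 0 1 2 (v 2),
    6 * r 1 0 1 2 (v 1) - r 1 1 1 1 (u 2) - 6 * r 1 1 1 2 (v 0) + 3 * r 0 1 1 2 (u 2)
        - 3 * r 1 0 1 1 (v 2)
      - r 0 1 1 1 (v 2) - 12 * r 0 0 1 2 (v 2) + 6 * r 1 1 2 2 (u 0) + 2 * r 0 2 2 2 (u 0)
          + 6 * r 1 0 2 2 (u 1)]

theorem compat_stdExpr {T : Fin 2 → Base → Base → Base → K}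
    (h₁ : ∀ m a b c, T m a b c = T m b a c) (h₂ : ∀ m a b c, T m a b c = T m a c b)
    (s : Fin 25) : compat (fun l i j k a => stdExpr l (fun m => T m a) i j k) s = 0 := by
  fin_cases s <;>
    simp only [compat, Fin.mk_one, Fin.zero_eta, Fin.reduceFinMk, Matrix.cons_val,
      stdExpr_zero_000, stdExpr_zero_001, stdExpr_zero_002, stdExpr_zero_011, stdExpr_zero_012,
    stdExpr_zero_022, stdExpr_zero_111, stdExpr_zero_112, stdExpr_zero_122, stdExpr_zero_222,
    stdExpr_one_000, stdExpr_one_001, stdExpr_one_002, stdExpr_one_011, stdExpr_one_012,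
    stdExpr_one_022, stdExpr_one_111, stdExpr_one_112, stdExpr_one_122, stdExpr_one_222] <;>
    simp only [h₁, h₂] <;> ring

/-- A code for the independent variables: sums of three codes determine the summands. -/
def code : Base → ℕ := Sum.elim ![1, 4, 16] ![64, 256, 1024]

/-- The third derivatives of `f` in a solution of `stdExpr l (T a) i j k = r l i j k a`. -/
def solF (r : Fin 2 → Fin 3 → Fin 3 → Fin 3 → Base → K) (n : ℕ) : K :=
  if n = 3 then -r 0 0 0 1 (u 0) + 2/3 * r 0 0 0 0 (u 1)
  else if n = 6 then 1/3 * r 0 0 0 1 (u 1) - 2/3 * r 0 0 1 1 (u 0)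
  else if n = 18 then 1/2 * r 0 0 0 2 (u 1) - r 0 0 1 2 (u 0) - 1/3 * r 1 0 0 0 (v 1)
  else if n = 66 then -2/3 * r 0 0 0 2 (u 0) + 4/9 * r 0 0 0 0 (u 2) - 1/9 * r 1 0 0 0 (v 0)
  else if n = 258 then 1/3 * r 1 0 0 0 (v 1)
  else if n = 1026 then 1/3 * r 1 0 0 0 (v 2)
  else if n = 9 then -1/3 * r 0 1 1 1 (u 0)
  else if n = 69 then -1/2 * r 0 0 1 2 (u 0) + 1/2 * r 0 0 0 1 (u 2) - 1/6 * r 1 0 0 0 (v 1)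
      - 1/4 * r 0 0 0 2 (u 1)
  else if n = 261 then -1/2 * r 0 1 1 2 (u 0) - 1/6 * r 1 1 1 1 (u 0)
  else if n = 33 then r 1 0 2 2 (u 0) - r 0 0 0 2 (v 2)
  else if n = 81 then 1/2 * r 1 0 0 1 (u 2) + 1/2 * r 0 0 0 2 (u 2) - r 0 0 2 2 (u 0)
      - 2/3 * r 1 0 0 0 (v 2)
  else if n = 273 then -1/2 * r 0 1 2 2 (u 0) - 1/2 * r 1 0 2 2 (u 0) + 1/2 * r 0 0 0 2 (v 2)
      - 1/2 * r 1 0 0 1 (v 2)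
  else if n = 1041 then -1/3 * r 0 2 2 2 (u 0) - 1/2 * r 1 0 0 2 (v 2)
  else if n = 129 then -r 1 0 0 2 (u 0) + 2/3 * r 0 0 0 0 (v 2) + 1/3 * r 1 0 0 0 (u 2)
      + 1/2 * r 0 0 0 2 (u 1) - r 0 0 1 2 (u 0)
      - 1/3 * r 1 0 0 0 (v 1)
  else if n = 321 then -r 1 0 1 2 (u 0) + 1/2 * r 0 0 0 1 (v 2) + 1/6 * r 1 0 0 0 (v 2)
  else if n = 513 then -r 1 1 1 2 (u 0) + r 1 0 0 1 (v 2)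
  else if n = 1281 then -1/2 * r 1 1 2 2 (u 0) + 1/2 * r 1 0 0 2 (v 2) + 1/6 * r 0 2 2 2 (u 0)
  else if n = 2049 then -1/3 * r 1 2 2 2 (u 0)
  else if n = 12 then -1/3 * r 0 1 1 1 (u 1)
  else if n = 24 then -1/3 * r 0 1 1 1 (u 2)
  else if n = 72 then -1/3 * r 0 1 1 1 (v 0)
  else if n = 264 then -1/3 * r 0 1 1 1 (v 1)
  else if n = 1032 then -1/3 * r 0 1 1 1 (v 2)
  else if n = 36 then -2 * r 0 0 1 2 (v 2) + r 1 1 2 2 (u 0) + 1/3 * r 0 2 2 2 (u 0)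
      + r 1 0 2 2 (u 1)
  else if n = 84 then -1/2 * r 0 1 1 2 (v 0) - 1/6 * r 1 1 1 1 (v 0)
  else if n = 276 then -1/2 * r 0 1 1 2 (u 2) - 1/6 * r 1 1 1 1 (u 2) + 2 * r 0 0 1 2 (v 2)
      - r 1 1 2 2 (u 0) - 1/3 * r 0 2 2 2 (u 0)
      - r 1 0 2 2 (u 1)
  else if n = 1044 then -r 1 0 1 2 (v 2) + 1/2 * r 1 1 2 2 (v 0) - 1/3 * r 0 2 2 2 (u 1)
  else if n = 132 then -r 1 0 0 2 (u 1) + r 0 0 0 1 (v 2) + 1/3 * r 1 0 0 0 (v 2)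
  else if n = 1092 then -r 1 0 2 2 (u 1) + r 1 0 1 2 (u 2) - 1/2 * r 0 0 2 2 (v 1)
      - 1/2 * r 1 0 0 2 (v 2) - 1/3 * r 0 2 2 2 (u 0)
      + r 0 0 1 2 (v 2)
  else if n = 516 then -r 1 1 1 2 (u 1) + r 1 0 1 1 (v 2) + 1/3 * r 0 1 1 1 (v 2)
  else if n = 1284 then -1/2 * r 1 1 2 2 (u 1) + 1/6 * r 0 2 2 2 (u 1) + r 1 0 1 2 (v 2)
      - 1/2 * r 1 1 2 2 (v 0)
  else if n = 2052 then -1/3 * r 1 2 2 2 (u 1)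
  else if n = 48 then r 1 0 2 2 (u 2) + 1/3 * r 0 2 2 2 (v 0) - 2 * r 0 0 2 2 (v 2)
      + 4/3 * r 1 2 2 2 (u 0)
  else if n = 96 then r 1 0 2 2 (v 0)
  else if n = 288 then r 1 0 2 2 (v 1) - r 1 1 2 2 (v 0)
  else if n = 1056 then -1/6 * r 0 2 2 2 (u 2) - 1/2 * r 1 1 2 2 (u 2) - 1/6 * r 1 1 2 2 (v 1)
      + 1/3 * r 1 1 1 2 (v 2)
      + 1/6 * r 0 2 2 2 (v 1)
  else if n = 144 then 1/3 * r 1 0 0 2 (u 2) + 1/3 * r 0 0 0 2 (v 2) - 2/3 * r 0 0 2 2 (v 0)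
      - 2/3 * r 1 0 2 2 (u 0)
  else if n = 336 then -1/2 * r 0 0 2 2 (v 1) + 1/2 * r 1 1 2 2 (u 0) - 1/2 * r 1 0 0 2 (v 2)
      - 1/6 * r 0 2 2 2 (u 0)
  else if n = 1104 then -1/6 * r 0 2 2 2 (v 0)
  else if n = 528 then -r 1 1 1 2 (u 2)
  else if n = 1296 then 1/6 * r 1 1 2 2 (v 1) - 1/3 * r 1 1 1 2 (v 2) - 1/6 * r 0 2 2 2 (v 1)
  else if n = 2064 then -1/3 * r 1 2 2 2 (u 2)
  else if n = 192 then -r 1 0 0 2 (v 0) + 3 * r 1 0 0 1 (u 2) + r 0 0 0 2 (u 2)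
      - 2 * r 0 0 2 2 (u 0) - 4/3 * r 1 0 0 0 (v 2)
  else if n = 384 then -r 1 0 0 2 (v 1) + r 1 0 1 1 (u 2) - 1/3 * r 0 1 1 1 (u 2)
      - 2 * r 1 0 1 2 (u 1) + 2 * r 0 0 1 1 (v 2)
      - r 0 1 2 2 (u 0) - r 1 0 2 2 (u 0) + r 0 0 0 2 (v 2)
  else if n = 576 then -r 1 1 1 2 (v 0)
  else if n = 1344 then -1/2 * r 1 1 2 2 (v 0)
  else if n = 2112 then -1/3 * r 1 2 2 2 (v 0)
  else if n = 768 then -r 1 1 1 2 (v 1) + 2/3 * r 1 1 1 1 (v 2)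
  else if n = 1536 then 1/3 * r 1 1 1 2 (v 2) - 2/3 * r 1 1 2 2 (v 1)
  else if n = 2304 then -1/3 * r 1 2 2 2 (v 1)
  else if n = 3072 then -1/3 * r 1 2 2 2 (v 2)
  else 0

/-- The third derivatives of `h` in a solution of `stdExpr l (T a) i j k = r l i j k a`. -/
def solH (r : Fin 2 → Fin 3 → Fin 3 → Fin 3 → Base → K) (n : ℕ) : K :=
  if n = 3 then 1/3 * r 0 0 0 0 (u 0)
  else if n = 6 then 1/3 * r 0 0 0 0 (u 1)
  else if n = 18 then 1/3 * r 0 0 0 0 (u 2)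
  else if n = 66 then 1/3 * r 0 0 0 0 (v 0)
  else if n = 258 then 1/3 * r 0 0 0 0 (v 1)
  else if n = 1026 then 1/3 * r 0 0 0 0 (v 2)
  else if n = 9 then -1/3 * r 0 0 1 1 (u 0) + 2/3 * r 0 0 0 1 (u 1)
  else if n = 21 then 1/2 * r 0 0 0 1 (u 2) + 1/4 * r 0 0 0 2 (u 1) - 1/2 * r 0 0 1 2 (u 0)
      - 1/6 * r 1 0 0 0 (v 1)
  else if n = 69 then 1/6 * r 1 0 0 0 (u 1) - 1/6 * r 0 0 0 1 (u 1) + 1/3 * r 0 0 1 1 (u 0)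
  else if n = 261 then 1/2 * r 0 0 0 1 (v 1) + 1/6 * r 1 0 0 0 (v 1)
  else if n = 1029 then 1/2 * r 0 0 0 1 (v 2) + 1/6 * r 1 0 0 0 (v 2)
  else if n = 33 then -r 0 0 2 2 (u 0) - 2/3 * r 1 0 0 0 (v 2) + r 1 0 0 1 (u 2) + r 0 0 0 2 (u 2)
  else if n = 81 then 1/6 * r 1 0 0 0 (u 2) - 1/4 * r 0 0 0 2 (u 1) + 1/2 * r 0 0 1 2 (u 0)
      + 1/6 * r 1 0 0 0 (v 1)
  else if n = 1041 then 1/2 * r 0 0 0 2 (v 2)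
  else if n = 129 then 2/9 * r 1 0 0 0 (v 0) + 1/3 * r 0 0 0 2 (u 0) - 2/9 * r 0 0 0 0 (u 2)
  else if n = 513 then 1/3 * r 1 1 1 1 (u 0)
  else if n = 1281 then 1/2 * r 1 0 0 1 (v 2)
  else if n = 2049 then r 1 0 0 2 (v 2) + 1/3 * r 0 2 2 2 (u 0)
  else if n = 12 then r 0 0 1 1 (u 1) - 2/3 * r 0 1 1 1 (u 0)
  else if n = 24 then r 0 0 1 1 (u 2)
  else if n = 72 then r 0 0 1 1 (v 0) - r 0 0 1 2 (u 0) + r 0 0 0 1 (u 2)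
      - 1/3 * r 1 0 0 0 (v 1) - 1/2 * r 0 0 0 2 (u 1)
  else if n = 264 then r 0 0 1 1 (v 1) - r 0 1 1 2 (u 0) - 1/3 * r 1 1 1 1 (u 0)
  else if n = 1032 then r 0 0 1 1 (v 2)
  else if n = 36 then r 0 0 2 2 (u 1) - r 0 1 1 2 (v 0) - 1/3 * r 1 1 1 1 (v 0)
  else if n = 276 then r 1 0 1 2 (u 1) + 1/3 * r 0 1 1 1 (u 2) - r 0 0 1 1 (v 2)
  else if n = 1044 then r 1 0 1 2 (u 2) - 1/2 * r 0 0 2 2 (v 1) - 1/2 * r 1 1 2 2 (u 0)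
      - 1/2 * r 1 0 0 2 (v 2) - 1/2 * r 0 2 2 2 (u 0)
      + 2 * r 0 0 1 2 (v 2) - r 1 0 2 2 (u 1)
  else if n = 324 then 1/2 * r 1 0 1 1 (v 0) + 1/6 * r 0 1 1 1 (v 0) - 2 * r 1 0 1 2 (u 0)
      + r 0 0 0 2 (v 1) + r 0 0 0 1 (v 2)
      + 1/3 * r 1 0 0 0 (v 2)
  else if n = 516 then 1/3 * r 1 1 1 1 (u 1)
  else if n = 1284 then 1/2 * r 1 0 1 1 (v 2) + 1/6 * r 0 1 1 1 (v 2)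
  else if n = 2052 then 1/3 * r 0 2 2 2 (u 1) + 2 * r 1 0 1 2 (v 2) - r 1 1 2 2 (v 0)
  else if n = 48 then r 0 0 2 2 (u 2) - 2/3 * r 0 2 2 2 (u 0) - r 1 0 0 2 (v 2)
      + 2 * r 1 0 2 2 (v 0)
  else if n = 96 then -1/3 * r 0 0 2 2 (v 0) + 2/3 * r 1 0 0 2 (u 2) + 2/3 * r 0 0 0 2 (v 2)
      - 4/3 * r 1 0 2 2 (u 0)
  else if n = 1056 then r 0 0 2 2 (v 2) - 2/3 * r 1 2 2 2 (u 0) - 1/3 * r 0 2 2 2 (v 0)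
  else if n = 144 then r 1 0 0 1 (u 2)
  else if n = 336 then 1/2 * r 1 0 1 1 (u 2) - 1/6 * r 0 1 1 1 (u 2) - r 1 0 1 2 (u 1)
      + r 0 0 1 1 (v 2)
  else if n = 528 then 1/3 * r 1 1 1 1 (u 2)
  else if n = 2064 then r 1 1 2 2 (u 2) + 1/3 * r 1 1 2 2 (v 1) - 2/3 * r 1 1 1 2 (v 2)
      - 1/3 * r 0 2 2 2 (v 1)
  else if n = 192 then r 1 0 0 1 (v 0) + r 0 0 1 2 (u 0) - r 0 0 0 1 (u 2)
      + 1/3 * r 1 0 0 0 (v 1) + 1/2 * r 0 0 0 2 (u 1)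
  else if n = 384 then 2 * r 1 0 1 2 (u 0) - r 0 0 0 2 (v 1) - r 0 0 0 1 (v 2)
      - 1/3 * r 1 0 0 0 (v 2)
  else if n = 576 then 1/3 * r 1 1 1 1 (v 0)
  else if n = 768 then 1/3 * r 1 1 1 1 (v 1)
  else if n = 1536 then 1/3 * r 1 1 1 1 (v 2)
  else if n = 2304 then -1/3 * r 1 1 2 2 (v 1) + 2/3 * r 1 1 1 2 (v 2)
  else if n = 3072 then r 1 1 2 2 (v 2) - 2/3 * r 1 2 2 2 (v 1)
  else 0

/-- A solution of `stdExpr l (T a) i j k = r l i j k a`, provided that `compat r = 0`. -/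
def solution (r : Fin 2 → Fin 3 → Fin 3 → Fin 3 → Base → K) (m : Fin 2) (a b c : Base) : K :=
  if m = 0 then solF r (code a + code b + code c) else solH r (code a + code b + code c)

set_option maxHeartbeats 4000000 in
theorem exists_stdExpr_eq [CharZero K] {r : Fin 2 → Fin 3 → Fin 3 → Fin 3 → Base → K}
    (hs : ∀ l i j k a, r l i j k a = r l j i k a) (hr : ∀ l i j k a, r l i j k a = r l j k i a)
    (h : ∀ s, compat r s = 0) :
    ∃ T : Fin 2 → Base → Base → Base → K,
      (∀ m a b c, T m a b c = T m b a c) ∧ (∀ m a b c, T m a b c = T m a c b) ∧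
      ∀ l i j k a, stdExpr l (fun m => T m a) i j k = r l i j k a := by
  have h₁ : ∀ m a b c, solution r m a b c = solution r m b a c := fun m a b c => by
    rw [solution, solution, add_comm (code a)]
  have h₂ : ∀ m a b c, solution r m a b c = solution r m a c b := fun m a b c => by
    rw [solution, solution, add_right_comm]
  refine ⟨solution r, h₁, h₂, fun l i j k a => ?_⟩
  refine forall_of_ordered (p := fun i j k => stdExpr l (fun m => solution r m a) i j k =
      r l i j k a)
    (fun i j k H => ?_) (fun i j k H => ?_) ?_ ?_ ?_ ?_ ?_ ?_ ?_ ?_ ?_ ?_ i j k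
  · rw [← hs, ← H, stdExpr, stdExpr, symExpr_swap _ _ _ _ (fun m b c => h₂ m a b c)]
  · rw [← hr, ← H, stdExpr, stdExpr, ← symExpr_rotate]
  all_goals
    clear hs hr h₁ h₂
    fin_cases l <;> rcases a with a | a <;> fin_cases a
  all_goals
    simp only [Fin.mk_one, Fin.zero_eta, Fin.reduceFinMk, stdExpr_zero_000, stdExpr_zero_001,
        stdExpr_zero_002, stdExpr_zero_011, stdExpr_zero_012,
    stdExpr_zero_022, stdExpr_zero_111, stdExpr_zero_112, stdExpr_zero_122, stdExpr_zero_222,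
    stdExpr_one_000, stdExpr_one_001, stdExpr_one_002, stdExpr_one_011, stdExpr_one_012,
    stdExpr_one_022, stdExpr_one_111, stdExpr_one_112, stdExpr_one_122, stdExpr_one_222]
    simp only [solution, code, solF, solH, Sum.elim_inl, Sum.elim_inr, Matrix.cons_val,
      Nat.reduceAdd, Nat.reduceEqDiff, reduceIte, one_ne_zero]
    try ring1
  · have hc := h 2
    simp only [compat, Matrix.cons_val] at hc
    linear_combination -hc
  · have hc := h 8
    simp only [compat, Matrix.cons_val] at hc
    linear_combination -1 / 9 * hc
  · have hc := h 9
    simp only [compat, Matrix.cons_val] at hc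
    linear_combination -1 / 9 * hc
  · have hc := h 13
    simp only [compat, Matrix.cons_val] at hc
    linear_combination -1 / 3 * hc
  · have hc := h 19
    simp only [compat, Matrix.cons_val] at hc
    linear_combination -1 / 3 * hc
  · have hc := h 12
    simp only [compat, Matrix.cons_val] at hc
    linear_combination -1 / 3 * hc
  · have hc := h 4
    simp only [compat, Matrix.cons_val] at hc
    linear_combination -1 / 3 * hc
  · have hc := h 20
    simp only [compat, Matrix.cons_val] at hc
    linear_combination -1 / 3 * hc
  · have hc := h 0
    simp only [compat, Matrix.cons_val] at hc
    linear_combination -1 / 3 * hc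
  · have hc := h 17
    simp only [compat, Matrix.cons_val] at hc
    linear_combination -1 / 6 * hc
  · have hc := h 14
    simp only [compat, Matrix.cons_val] at hc
    linear_combination -1 / 6 * hc
  · have hc := h 18
    simp only [compat, Matrix.cons_val] at hc
    linear_combination -1 / 2 * hc
  · have hc := h 15
    simp only [compat, Matrix.cons_val] at hc
    linear_combination -1 / 6 * hc
  · have hc := h 16
    simp only [compat, Matrix.cons_val] at hc
    linear_combination -1 / 6 * hc
  · have hc := h 24
    simp only [compat, Matrix.cons_val] at hc
    linear_combination -1 / 6 * hc
  · have hc := h 7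
    simp only [compat, Matrix.cons_val] at hc
    linear_combination -1 / 6 * hc
  · have hc := h 1
    simp only [compat, Matrix.cons_val] at hc
    linear_combination -1 / 3 * hc
  · have hc := h 21
    simp only [compat, Matrix.cons_val] at hc
    linear_combination -1 / 3 * hc
  · have hc := h 5
    simp only [compat, Matrix.cons_val] at hc
    linear_combination -1 / 3 * hc
  · have hc := h 22
    simp only [compat, Matrix.cons_val] at hc
    linear_combination -1 / 3 * hc
  · have hc := h 10
    simp only [compat, Matrix.cons_val] at hc
    linear_combination -1 / 3 * hc
  · have hc := h 23
    simp only [compat, Matrix.cons_val] at hc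
    linear_combination -hc
  · have hc := h 11
    simp only [compat, Matrix.cons_val] at hc
    linear_combination -1 / 3 * hc
  · have hc := h 6
    simp only [compat, Matrix.cons_val] at hc
    linear_combination -1 / 6 * hc
  · have hc := h 3
    simp only [compat, Matrix.cons_val] at hc
    linear_combination -hc

end LinDeg

namespace LinDeg

variable {K : Type*} [Field K]

/-! ### Normal form of the second derivatives

The vectors `u₀`, `v₀ + u₁`, `v₁` and `u₁`, `v₁ + u₂`, `v₂` form a basis `t p n` (`p < 2`,
    `n < 3`) of
the space of independent variables in which the solutions of `stdExpr l F i j k = 0` take a simple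
form. -/

/-- The values on the vectors `t p n` of a linear form given by its values on the independent
variables. -/
def frameVal (g : Base → K) : Fin 2 → Fin 3 → K :=
  ![![g (u 0), g (v 0) + g (u 1), g (v 1)], ![g (u 1), g (v 1) + g (u 2), g (v 2)]]

/-- The linear form with given values on the vectors `t p n`. -/
def frameExt (g : Fin 2 → Fin 3 → K) : Base → K :=
  Sum.elim ![g 0 0, g 1 0, g 1 1 - g 0 2] ![g 0 1 - g 1 0, g 0 2, g 1 2]

/-- The second derivatives `F`, evaluated on pairs of the vectors `t p n`. -/
def frame (F : Fin 2 → Base → Base → K) (m p : Fin 2) (n : Fin 3) (q : Fin 2) (n' : Fin 3) : K :=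
  frameVal (fun a => frameVal (F m a) q n') p n

/-- The general solution of `stdExpr l F i j k = 0`,
    evaluated on pairs of the vectors `t p n`. -/
def normalForm (A : Fin 2 → Fin 3 → Fin 3 → K) (b : Fin 4 → K)
    (m p : Fin 2) (n : Fin 3) (q : Fin 2) (n' : Fin 3) : K :=
  (if m = p then A q n n' else 0) + (if m = q then A p n' n else 0)
    + (![![0, 0, 1], ![0, -2, 0], ![1, 0, 0]] : Fin 3 → Fin 3 → K) n n'
      * ![![![-b 1, -b 2], ![-b 2, -b 3]], ![![b 0, b 1], ![b 1, b 2]]] m p q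

/-- The general solution of `stdExpr l F i j k = 0`. -/
def param (A : Fin 2 → Fin 3 → Fin 3 → K) (b : Fin 4 → K) (m : Fin 2) (a c : Base) : K :=
  frameExt (fun p n => frameExt (fun q n' => normalForm A b m p n q n') c) a

/-- The coefficients of the quartic forms obtained from `F` by taking a trace and restricting to the
diagonal. -/
def quarticPart (F : Fin 2 → Base → Base → K) (q : Fin 2) : Fin 5 → K :=
  let w := fun n n' => frame F 0 0 n q n' + frame F 1 1 n q n'
  ![w 0 0, w 0 1 + w 1 0, w 0 2 + w 1 1 + w 2 0, w 1 2 + w 2 1, w 2 2]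

/-- The coefficients of the cubic form obtained from the values of `F` on the pairs `t p 0`,
    `t q 2`. -/
def cubicPart (F : Fin 2 → Base → Base → K) : Fin 4 → K :=
  ![frame F 1 0 0 0 2, frame F 1 0 0 1 2 + frame F 1 1 0 0 2 - frame F 0 0 0 0 2,
    frame F 1 1 0 1 2 - frame F 0 0 0 1 2 - frame F 0 1 0 0 2, -frame F 0 1 0 1 2]

/-- The restriction of the bilinear forms `A q` to the diagonal. -/
def diagPart (A : Fin 2 → Fin 3 → Fin 3 → K) (q : Fin 2) : Fin 5 → K :=
  ![A q 0 0, A q 0 1 + A q 1 0, A q 0 2 + A q 1 1 + A q 2 0, A q 1 2 + A q 2 1, A q 2 2]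

/-- The coefficients of the products of the linear forms with coefficients `diagPart A · j` and the
binary cubic form with coefficients `b`. -/
def prodCoeff (A : Fin 2 → Fin 3 → Fin 3 → K) (b : Fin 4 → K) (i j : Fin 5) : K :=
  ![diagPart A 0 j * b 0, 3 * (diagPart A 0 j * b 1) + diagPart A 1 j * b 0,
    3 * (diagPart A 0 j * b 2) + 3 * (diagPart A 1 j * b 1),
    diagPart A 0 j * b 3 + 3 * (diagPart A 1 j * b 2), diagPart A 1 j * b 3] i

theorem param_symm (A : Fin 2 → Fin 3 → Fin 3 → K) (b : Fin 4 → K) (m : Fin 2) (a c : Base) :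
    param A b m a c = param A b m c a := by
  have h : ∀ p n q n', normalForm A b m p n q n' = normalForm A b m q n' p n := by
    intro p n q n'
    have h₁ : (![![0, 0, 1], ![0, -2, 0], ![1, 0, 0]] : Fin 3 → Fin 3 → K) n n' =
        (![![0, 0, 1], ![0, -2, 0], ![1, 0, 0]] : Fin 3 → Fin 3 → K) n' n := by
      fin_cases n <;> fin_cases n' <;> rfl
    have h₂ : (![![![-b 1, -b 2], ![-b 2, -b 3]], ![![b 0, b 1], ![b 1, b 2]]] :
        Fin 2 → Fin 2 → Fin 2 → K) m p q =
        (![![![-b 1, -b 2], ![-b 2, -b 3]], ![![b 0, b 1], ![b 1, b 2]]] :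
        Fin 2 → Fin 2 → Fin 2 → K) m q p := by
      fin_cases m <;> fin_cases p <;> fin_cases q <;> rfl
    rw [normalForm, normalForm, h₁, h₂]
    ring
  have hs : ∀ g : Fin 2 → Fin 3 → Fin 2 → Fin 3 → K,
      frameExt (fun p n => frameExt (fun q n' => g p n q n') c) a =
      frameExt (fun q n' => frameExt (fun p n => g p n q n') a) c := by
    intro g
    rcases a with a | a <;> rcases c with c | c <;> fin_cases a <;> fin_cases c <;>
      simp only [frameExt, Fin.mk_one, Fin.zero_eta, Fin.reduceFinMk, Sum.elim_inl, Sum.elim_inr,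
        Matrix.cons_val] <;> ring
  rw [param, hs]
  simp only [h]
  rfl

theorem stdExpr_param (A : Fin 2 → Fin 3 → Fin 3 → K) (b : Fin 4 → K) (l : Fin 2) (i j k : Fin 3) :
    stdExpr l (param A b) i j k = 0 := by
  refine forall_of_ordered (p := fun i j k => stdExpr l (param A b) i j k = 0)
    (fun i j k H => ?_) (fun i j k H => ?_) ?_ ?_ ?_ ?_ ?_ ?_ ?_ ?_ ?_ ?_ i j k
  · rw [← H, stdExpr, stdExpr, symExpr_swap _ _ _ _ (param_symm A b)]
  · rw [← H, stdExpr, stdExpr, ← symExpr_rotate]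
  all_goals
    fin_cases l <;>
    simp only [Fin.mk_one, Fin.zero_eta, stdExpr_zero_000, stdExpr_zero_001, stdExpr_zero_002,
        stdExpr_zero_011, stdExpr_zero_012,
    stdExpr_zero_022, stdExpr_zero_111, stdExpr_zero_112, stdExpr_zero_122, stdExpr_zero_222,
    stdExpr_one_000, stdExpr_one_001, stdExpr_one_002, stdExpr_one_011, stdExpr_one_012,
    stdExpr_one_022, stdExpr_one_111, stdExpr_one_112, stdExpr_one_122, stdExpr_one_222] <;>
    simp only [param, frameExt, normalForm, Sum.elim_inl, Sum.elim_inr, Matrix.cons_val, reduceIte,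
      one_ne_zero, zero_ne_one] <;> ring

theorem quarticPart_param (A : Fin 2 → Fin 3 → Fin 3 → K) (b : Fin 4 → K) (q : Fin 2) (j : Fin 5) :
    quarticPart (param A b) q j = 3 * diagPart A q j := by
  fin_cases q <;> fin_cases j <;>
    simp only [quarticPart, diagPart, frame, frameVal, Fin.mk_one, Fin.zero_eta, Fin.reduceFinMk,
      param, frameExt, normalForm, Sum.elim_inl, Sum.elim_inr, Matrix.cons_val, reduceIte,
      one_ne_zero, zero_ne_one] <;> ring

theorem cubicPart_param (A : Fin 2 → Fin 3 → Fin 3 → K) (b : Fin 4 → K) :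
    cubicPart (param A b) = ![b 0, 3 * b 1, 3 * b 2, b 3] := by
  funext i
  fin_cases i <;>
    simp only [cubicPart, frame, frameVal, Fin.mk_one, Fin.zero_eta, Fin.reduceFinMk, param,
        frameExt, normalForm, Sum.elim_inl, Sum.elim_inr, Matrix.cons_val, reduceIte,
      one_ne_zero, zero_ne_one] <;> ring

theorem eq_param [CharZero K] {F : Fin 2 → Base → Base → K} (hF : ∀ m a b, F m a b = F m b a)
    (h : ∀ l i j k, stdExpr l F i j k = 0) : ∃ A b, F = param A b := by
  let b : Fin 4 → K :=
    ![cubicPart F 0, cubicPart F 1 / 3, cubicPart F 2 / 3, cubicPart F 3]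
  let ω : Fin 3 → Fin 3 → K := ![![0, 0, 1], ![0, -2, 0], ![1, 0, 0]]
  refine ⟨![fun n n' => frame F 1 1 n 0 n' - ω n n' * b 1,
    fun n n' => frame F 0 0 n 1 n' + ω n n' * b 2], b, ?_⟩
  have h0000 := h 0 0 0 0
  have h0001 := h 0 0 0 1
  have h0002 := h 0 0 0 2
  have h0011 := h 0 0 1 1
  have h0012 := h 0 0 1 2
  have h0022 := h 0 0 2 2
  have h0111 := h 0 1 1 1
  have h0112 := h 0 1 1 2
  have h0122 := h 0 1 2 2
  have h0222 := h 0 2 2 2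
  have h1000 := h 1 0 0 0
  have h1001 := h 1 0 0 1
  have h1002 := h 1 0 0 2
  have h1011 := h 1 0 1 1
  have h1012 := h 1 0 1 2
  have h1022 := h 1 0 2 2
  have h1111 := h 1 1 1 1
  have h1112 := h 1 1 1 2
  have h1122 := h 1 1 2 2
  have h1222 := h 1 2 2 2
  simp only [stdExpr_zero_000, stdExpr_zero_001, stdExpr_zero_002, stdExpr_zero_011,
      stdExpr_zero_012,
    stdExpr_zero_022, stdExpr_zero_111, stdExpr_zero_112, stdExpr_zero_122, stdExpr_zero_222,
    stdExpr_one_000, stdExpr_one_001, stdExpr_one_002, stdExpr_one_011, stdExpr_one_012,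
    stdExpr_one_022, stdExpr_one_111, stdExpr_one_112, stdExpr_one_122, stdExpr_one_222,
        hF _ (u 1) (u 0),
    hF _ (u 2) (u 0), hF _ (u 2) (u 1), hF _ (v 1) (v 0), hF _ (v 2) (v 0),
        hF _ (v 2) (v 1)] at h0000 h0001 h0002 h0011 h0012 h0022 h0111 h0112 h0122 h0222 h1000 h1001 h1002 h1011 h1012 h1022 h1111 h1112 h1122 h1222
  funext m a c
  wlog hac : code a ≤ code c generalizing a c
  · rw [hF, param_symm]
    exact this c a (le_of_not_ge hac)
  fin_cases m <;> rcases a with a | a <;> rcases c with c | c <;> fin_cases a <;> fin_cases c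
  all_goals
    first
    | exact absurd hac (by decide)
    | clear hac
  all_goals
    simp only [b, ω, cubicPart, frame, frameVal, Fin.mk_one, Fin.zero_eta, Fin.reduceFinMk, param,
        frameExt, normalForm, Sum.elim_inl, Sum.elim_inr, Matrix.cons_val, reduceIte,
      one_ne_zero, zero_ne_one]
    try simp only [hF _ (u 1) (u 0), hF _ (u 2) (u 0), hF _ (u 2) (u 1), hF _ (v 1) (v 0),
      hF _ (v 2) (v 0), hF _ (v 2) (v 1), hF _ (v _) (u _)]
  · linear_combination -h0001
  · ring
  · ring
  · linear_combination -1/3 * h0111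
  · linear_combination -1/2 * h0112 - 1/6 * h1111
  · linear_combination -h0122 - 2 * h1112
  · linear_combination -1/2 * h0002 - h0011 - 1/2 * h1001
  · ring
  · ring
  · linear_combination 1/3 * h0111
  · ring
  · ring
  · linear_combination h1012 + h0112 + 2/3 * h1111
  · linear_combination h1112
  · linear_combination -1/6 * h0222 - 1/2 * h1122
  · linear_combination -4/3 * h0111 - h1002 - 2 * h0012 - 2 * h1011
  · linear_combination -h1012 - 1/2 * h0112 - 1/2 * h1111
  · ring
  · linear_combination -h1112
  · ring
  · linear_combination -1/3 * h1222
  · linear_combination 1/3 * h0000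
  · ring
  · ring
  · linear_combination h0011
  · linear_combination 1/2 * h0111 + h0012 + 1/2 * h1011
  · linear_combination h0022 + 2 * h1012 + 2 * h0112 + 4/3 * h1111
  · linear_combination 1/6 * h1000 + 1/2 * h0001
  · ring
  · ring
  · linear_combination -h0011
  · ring
  · ring
  · linear_combination -2/3 * h0111 - h0012 - h1011
  · linear_combination -1/3 * h1111
  · linear_combination 1/2 * h0122 + 1/2 * h1022 + h1112
  · linear_combination 2 * h0011 + h1001
  · linear_combination 1/2 * h1011 + 1/6 * h0111
  · ring
  · linear_combination 1/3 * h1111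
  · ring
  · linear_combination h1122


end LinDeg

namespace LinDeg

variable {K : Type*} [Field K]

set_option maxHeartbeats 4000000 in
theorem compat_quadExpr_param (A : Fin 2 → Fin 3 → Fin 3 → K) (b : Fin 4 → K) (s : Fin 25) :
    compat (quadExpr (param A b)) s =
    ![18 * prodCoeff A b 0 4,
    -18 * prodCoeff A b 4 0,
    -18 * prodCoeff A b 0 0,
    18 * prodCoeff A b 4 4,
    -6 * prodCoeff A b 0 2,
    6 * prodCoeff A b 4 2,
    18 * prodCoeff A b 4 3,
    -18 * prodCoeff A b 4 3 + 36 * prodCoeff A b 3 4,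
    36 * prodCoeff A b 1 0 - 18 * prodCoeff A b 0 1,
    18 * prodCoeff A b 1 0 - 36 * prodCoeff A b 0 1,
    18 * prodCoeff A b 4 2 - 18 * prodCoeff A b 3 3 + 18 * prodCoeff A b 2 4,
    -6 * prodCoeff A b 4 2 + 18 * prodCoeff A b 2 4,
    -18 * prodCoeff A b 2 0 + 18 * prodCoeff A b 1 1 - 18 * prodCoeff A b 0 2,
    -18 * prodCoeff A b 2 0 + 6 * prodCoeff A b 0 2,
    -36 * prodCoeff A b 4 0 + 18 * prodCoeff A b 3 1 - 6 * prodCoeff A b 2 2,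
    -18 * prodCoeff A b 4 0 + 6 * prodCoeff A b 2 2 - 18 * prodCoeff A b 0 4,
    -18 * prodCoeff A b 4 0 + 12 * prodCoeff A b 2 2 - 18 * prodCoeff A b 1 3
        + 18 * prodCoeff A b 0 4,
    -18 * prodCoeff A b 3 0 + 12 * prodCoeff A b 1 2 - 18 * prodCoeff A b 0 3,
    -6 * prodCoeff A b 3 0 + 6 * prodCoeff A b 2 1 - 6 * prodCoeff A b 1 2 + 6 * prodCoeff A b 0 3,
    -6 * prodCoeff A b 1 2 + 18 * prodCoeff A b 0 3,
    -12 * prodCoeff A b 1 2 + 18 * prodCoeff A b 0 3,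
    -18 * prodCoeff A b 4 1 + 12 * prodCoeff A b 3 2,
    -18 * prodCoeff A b 4 1 + 6 * prodCoeff A b 3 2,
    -6 * prodCoeff A b 4 1 + 6 * prodCoeff A b 3 2 - 6 * prodCoeff A b 2 3 + 6 * prodCoeff A b 1 4,
    18 * prodCoeff A b 4 1 - 12 * prodCoeff A b 3 2 + 18 * prodCoeff A b 1 4] s := by
  fin_cases s
  all_goals
    simp only [compat, Fin.mk_one, Fin.zero_eta, Fin.reduceFinMk, Matrix.cons_val, quadExpr,
      symExpr, expr, reduceIte, one_ne_zero]
    simp only [prodCoeff, diagPart, param, frameExt, normalForm, Sum.elim_inl, Sum.elim_inr,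
        Matrix.cons_val, reduceIte,
      one_ne_zero, zero_ne_one]
    ring

end LinDeg

namespace LinDeg

variable {K : Type*} [Field K]

theorem prodCoeff_eq_zero [CharZero K] {A : Fin 2 → Fin 3 → Fin 3 → K} {b : Fin 4 → K}
    (h : ∀ s, compat (quadExpr (param A b)) s = 0) (i j : Fin 5) : prodCoeff A b i j = 0 := by
  simp only [compat_quadExpr_param] at h
  have h0 := h 0
  have h1 := h 1
  have h2 := h 2
  have h3 := h 3
  have h4 := h 4
  have h5 := h 5
  have h6 := h 6
  have h7 := h 7
  have h8 := h 8
  have h9 := h 9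
  have h10 := h 10
  have h11 := h 11
  have h12 := h 12
  have h13 := h 13
  have h14 := h 14
  have h15 := h 15
  have h16 := h 16
  have h17 := h 17
  have h18 := h 18
  have h19 := h 19
  have h20 := h 20
  have h21 := h 21
  have h22 := h 22
  have h23 := h 23
  have h24 := h 24
  simp only [Matrix.cons_val] at h0 h1 h2 h3 h4 h5 h6 h7 h8 h9 h10 h11 h12 h13 h14 h15 h16 h17 h18 h19 h20 h21 h22 h23 h24
  fin_cases i <;> fin_cases j <;> simp only [Fin.mk_one, Fin.zero_eta, Fin.reduceFinMk]
  · linear_combination -1/18 * h2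
  · linear_combination 1/54 * h8 - 1/27 * h9
  · linear_combination -1/6 * h4
  · linear_combination 1/9 * h19 - 1/18 * h20
  · linear_combination 1/18 * h0
  · linear_combination -1/54 * h9 + 1/27 * h8
  · linear_combination 1/18 * h12 - 2/9 * h4 - 1/18 * h13
  · linear_combination 1/6 * h19 - 1/6 * h20
  · linear_combination -1/18 * h16 + 1/6 * h0 - 1/18 * h1 + 1/9 * h15
  · linear_combination 1/18 * h21 + 1/18 * h24
  · linear_combination -1/18 * h13 - 1/18 * h4
  · linear_combination 1/18 * h19 - 1/18 * h17 + 1/6 * h18 - 1/6 * h20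
  · linear_combination -1/6 * h1 + 1/6 * h15 + 1/6 * h0
  · linear_combination 1/18 * h24 + 1/6 * h21 - 1/6 * h23 - 1/18 * h22
  · linear_combination 1/18 * h5 + 1/18 * h11
  · linear_combination -1/18 * h20 - 1/18 * h17
  · linear_combination 1/18 * h15 + 1/18 * h0 - 1/6 * h1 + 1/18 * h14
  · linear_combination 1/6 * h21 - 1/6 * h22
  · linear_combination 1/18 * h11 + 2/9 * h5 - 1/18 * h10
  · linear_combination 1/36 * h7 + 1/36 * h6
  · linear_combination -1/18 * h1
  · linear_combination -1/9 * h22 + 1/18 * h21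
  · linear_combination 1/6 * h5
  · linear_combination 1/18 * h6
  · linear_combination 1/18 * h3

theorem eq_zero_or_of_prodCoeff_eq_zero [CharZero K] {A : Fin 2 → Fin 3 → Fin 3 → K}
    {b : Fin 4 → K} (h : ∀ i j, prodCoeff A b i j = 0) : b = 0 ∨ ∀ q j, diagPart A q j = 0 := by
  refine or_iff_not_imp_right.2 fun hA => ?_
  obtain ⟨q, j, hqj⟩ : ∃ q j, diagPart A q j ≠ 0 := by
    simpa only [not_forall] using hA
  have e0 : diagPart A 0 j * b 0 = 0 := h 0 j
  have e1 : 3 * (diagPart A 0 j * b 1) + diagPart A 1 j * b 0 = 0 := h 1 j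
  have e2 : 3 * (diagPart A 0 j * b 2) + 3 * (diagPart A 1 j * b 1) = 0 := h 2 j
  have e3 : diagPart A 0 j * b 3 + 3 * (diagPart A 1 j * b 2) = 0 := h 3 j
  have e4 : diagPart A 1 j * b 3 = 0 := h 4 j
  have key : b 0 = 0 ∧ b 1 = 0 ∧ b 2 = 0 ∧ b 3 = 0 := by
    by_cases h0 : diagPart A 0 j = 0
    · have h1 : diagPart A 1 j ≠ 0 := by
        fin_cases q
        · exact absurd h0 hqj
        · exact hqj
      simp_all
    · simp_all
  funext i
  fin_cases i
  exacts [key.1, key.2.1, key.2.2.1, key.2.2.2]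

/-- If third derivatives solving the differentiated conditions exist, then one of the two parts of
the second derivatives vanishes. -/
theorem cubicPart_eq_zero_or_quarticPart_eq_zero [CharZero K] {F : Fin 2 → Base → Base → K}
    {T : Fin 2 → Base → Base → Base → K} (hF : ∀ m a b, F m a b = F m b a)
    (h₁ : ∀ m a b c, T m a b c = T m b a c) (h₂ : ∀ m a b c, T m a b c = T m a c b)
    (h : ∀ l i j k, stdExpr l F i j k = 0)
    (hT : ∀ l i j k a, stdExpr l (fun m => T m a) i j k + quadExpr F l i j k a = 0) :
    cubicPart F = 0 ∨ quarticPart F = 0 := by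
  obtain ⟨A, b, rfl⟩ := eq_param hF h
  have hc : ∀ s, compat (quadExpr (param A b)) s = 0 := by
    have hq : quadExpr (param A b) =
        fun l i j k a => stdExpr l (fun m b c => -T m a b c) i j k := by
      funext l i j k a
      rw [eq_neg_of_add_eq_zero_right (hT l i j k a)]
      simp only [stdExpr, symExpr, expr]
      split_ifs <;> ring
    rw [hq]
    exact compat_stdExpr (T := fun m a b c => -T m a b c) (fun m a b c => by rw [h₁])
      (fun m a b c => by rw [h₂])
  rcases eq_zero_or_of_prodCoeff_eq_zero (prodCoeff_eq_zero hc) with hb | hA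
  · refine Or.inl ?_
    rw [cubicPart_param, hb]
    funext i
    fin_cases i <;> simp
  · refine Or.inr ?_
    funext q j
    rw [quarticPart_param, hA, mul_zero]
    rfl

theorem exists_third_derivatives [CharZero K] {F : Fin 2 → Base → Base → K}
    (hF : ∀ m a b, F m a b = F m b a) (h : ∀ l i j k, stdExpr l F i j k = 0)
    (hab : cubicPart F = 0 ∨ quarticPart F = 0) :
    ∃ T : Fin 2 → Base → Base → Base → K,
      (∀ m a b c, T m a b c = T m b a c) ∧ (∀ m a b c, T m a b c = T m a c b) ∧
      ∀ l i j k a, stdExpr l (fun m => T m a) i j k + quadExpr F l i j k a = 0 := by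
  have hc : ∀ s, compat (quadExpr F) s = 0 := by
    obtain ⟨A, b, rfl⟩ := eq_param hF h
    have hp : ∀ i j, prodCoeff A b i j = 0 := by
      rcases hab with hb | hA
      · rw [cubicPart_param] at hb
        have h0 : b 0 = 0 := congrFun hb 0
        have h1 : b 1 = 0 := by simpa using congrFun hb 1
        have h2 : b 2 = 0 := by simpa using congrFun hb 2
        have h3 : b 3 = 0 := congrFun hb 3
        intro i j
        fin_cases i <;> simp [prodCoeff, h0, h1, h2, h3]
      · have hA' : ∀ q j, diagPart A q j = 0 := fun q j => by
          have := congrFun (congrFun hA q) j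
          rw [quarticPart_param] at this
          simpa using this
        intro i j
        fin_cases i <;> simp [prodCoeff, hA']
    intro s
    rw [compat_quadExpr_param]
    simp only [hp]
    fin_cases s <;> simp
  have hc' : ∀ s, compat (fun l i j k a => -quadExpr F l i j k a) s = 0 := by
    intro s
    have : compat (fun l i j k a => -quadExpr F l i j k a) s = -compat (quadExpr F) s := by
      fin_cases s <;>
        simp only [compat, Fin.mk_one, Fin.zero_eta, Fin.reduceFinMk, Matrix.cons_val] <;> ring
    rw [this, hc, neg_zero]
  obtain ⟨T, h₁, h₂, hT⟩ := exists_stdExpr_eq (r := fun l i j k a => -quadExpr F l i j k a)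
    (fun l i j k a => by rw [quadExpr, quadExpr, symExpr_swap _ _ _ _ hF])
    (fun l i j k a => by rw [quadExpr, quadExpr, symExpr_rotate]) hc'
  exact ⟨T, h₁, h₂, fun l i j k a => by rw [hT, neg_add_cancel]⟩

/-- Second derivatives with prescribed values of the twenty conditions. -/
def secondSolution (c : Fin 2 → Fin 10 → K) (m : Fin 2) (a b : Base) : K :=
  let n := code a + code b
  if m = 0 then
    if n = 65 then -1/2 * c 0 2
    else if n = 8 then -1/3 * c 0 6
    else if n = 68 then -c 0 4
    else if n = 260 then -1/2 * c 0 7 - 1/6 * c 1 6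
    else if n = 272 then -1/2 * c 0 8
    else if n = 1040 then -1/6 * c 0 9
    else if n = 128 then -c 1 2
    else if n = 1088 then -1/2 * c 1 5
    else if n = 512 then -c 1 7
    else if n = 1280 then -1/2 * c 1 8
    else if n = 2048 then -1/3 * c 1 9
    else 0
  else
    if n = 2 then 1/3 * c 0 0
    else if n = 5 then 1/2 * c 0 1
    else if n = 65 then 1/6 * c 1 0
    else if n = 257 then 1/2 * c 1 1
    else if n = 8 then c 0 3
    else if n = 260 then 1/2 * c 1 3 + 1/6 * c 0 6
    else if n = 32 then c 0 5
    else if n = 272 then c 1 4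
    else if n = 512 then 1/3 * c 1 6
    else 0

/-- The ordered triples of indices. -/
def triple : Fin 10 → Fin 3 × Fin 3 × Fin 3 :=
  ![(0, 0, 0), (0, 0, 1), (0, 0, 2), (0, 1, 1), (0, 1, 2), (0, 2, 2), (1, 1, 1), (1, 1, 2),
    (1, 2, 2), (2, 2, 2)]

theorem stdExpr_secondSolution [CharZero K] (c : Fin 2 → Fin 10 → K) (l : Fin 2) (s : Fin 10) :
    stdExpr l (secondSolution c) (triple s).1 (triple s).2.1 (triple s).2.2 = c l s := by
  fin_cases l <;> fin_cases s <;>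
    simp only [triple, Fin.mk_one, Fin.zero_eta, Fin.reduceFinMk, Matrix.cons_val,
      stdExpr_zero_000, stdExpr_zero_001, stdExpr_zero_002, stdExpr_zero_011, stdExpr_zero_012,
    stdExpr_zero_022, stdExpr_zero_111, stdExpr_zero_112, stdExpr_zero_122, stdExpr_zero_222,
    stdExpr_one_000, stdExpr_one_001, stdExpr_one_002, stdExpr_one_011, stdExpr_one_012,
    stdExpr_one_022, stdExpr_one_111, stdExpr_one_112, stdExpr_one_122, stdExpr_one_222] <;>
    simp only [secondSolution, code, Sum.elim_inl, Sum.elim_inr, Matrix.cons_val, Nat.reduceAdd,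
      Nat.reduceEqDiff, reduceIte, one_ne_zero] <;>
    ring

theorem stdExpr_add (F G : Fin 2 → Base → Base → K) (l : Fin 2) (i j k : Fin 3) :
    stdExpr l (F + G) i j k = stdExpr l F i j k + stdExpr l G i j k := by
  simp only [stdExpr, symExpr, expr, Pi.add_apply]
  split_ifs <;> ring

theorem stdExpr_smul (r : K) (F : Fin 2 → Base → Base → K) (l : Fin 2) (i j k : Fin 3) :
    stdExpr l (r • F) i j k = r * stdExpr l F i j k := by
  simp only [stdExpr, symExpr, expr, Pi.smul_apply, smul_eq_mul]
  split_ifs <;> ring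

theorem quarticPart_add (F G : Fin 2 → Base → Base → K) :
    quarticPart (F + G) = quarticPart F + quarticPart G := by
  funext q j
  fin_cases q <;> fin_cases j <;>
    simp only [quarticPart, frame, frameVal, Fin.mk_one, Fin.zero_eta, Fin.reduceFinMk,
      Matrix.cons_val, Pi.add_apply] <;> ring

theorem quarticPart_smul (r : K) (F : Fin 2 → Base → Base → K) :
    quarticPart (r • F) = r • quarticPart F := by
  funext q j
  fin_cases q <;> fin_cases j <;>
    simp only [quarticPart, frame, frameVal, Fin.mk_one, Fin.zero_eta, Fin.reduceFinMk,
      Matrix.cons_val, Pi.smul_apply, smul_eq_mul] <;> ring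

theorem cubicPart_add (F G : Fin 2 → Base → Base → K) :
    cubicPart (F + G) = cubicPart F + cubicPart G := by
  funext i
  fin_cases i <;>
    simp only [cubicPart, frame, frameVal, Fin.mk_one, Fin.zero_eta, Fin.reduceFinMk,
      Matrix.cons_val, Pi.add_apply] <;> ring

theorem cubicPart_smul (r : K) (F : Fin 2 → Base → Base → K) :
    cubicPart (r • F) = r • cubicPart F := by
  funext i
  fin_cases i <;>
    simp only [cubicPart, frame, frameVal, Fin.mk_one, Fin.zero_eta, Fin.reduceFinMk,
      Matrix.cons_val, Pi.smul_apply, smul_eq_mul] <;> ring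

theorem exists_diagPart_eq (a : Fin 2 → Fin 5 → K) : ∃ A, diagPart A = a := by
  refine ⟨fun q => ![![a q 0, a q 1, a q 2], ![0, 0, a q 3], ![0, 0, a q 4]], ?_⟩
  funext q j
  fin_cases j <;> simp [diagPart]

/-- The twenty conditions, the quartic part and the cubic part are independent. -/
theorem exists_stdExpr_quarticPart_cubicPart [CharZero K] (c : Fin 2 → Fin 10 → K)
    (a : Fin 2 → Fin 5 → K) (d : Fin 4 → K) :
    ∃ F : Fin 2 → Base → Base → K, (∀ m a b, F m a b = F m b a) ∧
      (∀ l s, stdExpr l F (triple s).1 (triple s).2.1 (triple s).2.2 = c l s) ∧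
      quarticPart F = a ∧ cubicPart F = d := by
  obtain ⟨G, hG, hGc⟩ : ∃ G : Fin 2 → Base → Base → K, (∀ m a b, G m a b = G m b a) ∧
      ∀ l s, stdExpr l G (triple s).1 (triple s).2.1 (triple s).2.2 = c l s :=
    ⟨secondSolution c, fun m x y => by simp only [secondSolution, add_comm (code x)],
      stdExpr_secondSolution c⟩
  obtain ⟨A, hA⟩ := exists_diagPart_eq ((3 : K)⁻¹ • (a - quarticPart G))
  obtain ⟨d', hd⟩ : ∃ d', d' = d - cubicPart G := ⟨_, rfl⟩
  refine ⟨G + param A ![d' 0, d' 1 / 3, d' 2 / 3, d' 3], fun m x y => ?_, fun l s => ?_, ?_, ?_⟩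
  · rw [Pi.add_apply, Pi.add_apply, Pi.add_apply, Pi.add_apply, Pi.add_apply, hG, param_symm]
  · rw [stdExpr_add, stdExpr_param, hGc, add_zero]
  · rw [quarticPart_add]
    funext q j
    rw [Pi.add_apply, Pi.add_apply, quarticPart_param, hA]
    simp
  · rw [cubicPart_add, cubicPart_param]
    have : (![d' 0, 3 * (d' 1 / 3), 3 * (d' 2 / 3), d' 3] : Fin 4 → K) = d' := by
      funext i
      fin_cases i <;> simp [mul_div_cancel₀]
    exact (congrArg (cubicPart G + ·) (this.trans hd)).trans (add_sub_cancel _ _)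

end LinDeg

namespace LinDeg

open MvPolynomial

/-! ### Symmetric functions as functions on symmetric powers -/

section Sym

variable {α β : Type*}

theorem exists_eq_cons_cons (s : Sym α 2) : ∃ p : α × α, p.1 ::ₛ p.2 ::ₛ Sym.nil = s := by
  obtain ⟨a, s, rfl⟩ := s.exists_eq_cons_of_succ
  obtain ⟨b, s, rfl⟩ := s.exists_eq_cons_of_succ
  exact ⟨(a, b), by rw [Sym.eq_nil_of_card_zero s]⟩

/-- An ordering of an unordered pair. -/
noncomputable def symRep (s : Sym α 2) : α × α := (exists_eq_cons_cons s).choose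

theorem symRep_spec (s : Sym α 2) : (symRep s).1 ::ₛ (symRep s).2 ::ₛ Sym.nil = s :=
  (exists_eq_cons_cons s).choose_spec

theorem eq_of_cons_cons_eq {f : α → α → β} (hf : ∀ a b, f a b = f b a) {a b a' b' : α}
    (h : a ::ₛ b ::ₛ Sym.nil = a' ::ₛ b' ::ₛ Sym.nil) : f a b = f a' b' := by
  have h := congrArg (fun s : Sym α 2 => (s : Multiset α)) h
  simp only [Sym.coe_cons, Sym.coe_nil, Multiset.cons_eq_cons] at h
  rcases h with ⟨rfl, ⟨rfl, -⟩ | ⟨-, cs, h, -⟩⟩ | ⟨-, cs, h₁, h₂⟩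
  · rfl
  · simp at h
  · rcases h₁ with ⟨rfl, rfl⟩ | ⟨-, cs', h, -⟩
    · rcases h₂ with ⟨rfl, -⟩ | ⟨-, cs', h, -⟩
      · exact hf _ _
      · simp at h
    · simp at h

theorem eq_of_cons_cons_cons_eq {f : α → α → α → β} (h₁ : ∀ a b c, f a b c = f b a c)
    (h₂ : ∀ a b c, f a b c = f a c b) {a b c a' b' c' : α}
    (h : a ::ₛ b ::ₛ c ::ₛ Sym.nil = a' ::ₛ b' ::ₛ c' ::ₛ Sym.nil) : f a b c = f a' b' c' := by
  classical
  have key : ∀ (a b c b' c' : α), a ::ₛ b ::ₛ c ::ₛ Sym.nil = a ::ₛ b' ::ₛ c' ::ₛ Sym.nil →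
      f a b c = f a b' c' := fun a b c b' c' h =>
    eq_of_cons_cons_eq (h₂ a) ((Sym.cons_inj_right a _ _).1 h)
  have ha : a ∈ a' ::ₛ b' ::ₛ c' ::ₛ Sym.nil := h ▸ Sym.mem_cons_self _ _
  simp only [Sym.mem_cons, Sym.notMem_nil, or_false] at ha
  rcases ha with rfl | rfl | rfl
  · exact key _ _ _ _ _ h
  · rw [h₁ a', key a b c a' c']
    rw [h, Sym.cons_swap]
  · rw [h₂ a', h₁ a', key a b c a' b']
    rw [h, Sym.cons_swap b', Sym.cons_swap a']

theorem exists_sym_three {f : α → α → α → β} (h₁ : ∀ a b c, f a b c = f b a c)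
    (h₂ : ∀ a b c, f a b c = f a c b) :
    ∃ g : Sym α 3 → β, ∀ a b c, g (a ::ₛ b ::ₛ c ::ₛ Sym.nil) = f a b c := by
  have h : ∀ s : Sym α 3, ∃ p : α × α × α, p.1 ::ₛ p.2.1 ::ₛ p.2.2 ::ₛ Sym.nil = s := by
    intro s
    obtain ⟨a, s, rfl⟩ := s.exists_eq_cons_of_succ
    obtain ⟨p, rfl⟩ := exists_eq_cons_cons s
    exact ⟨(a, p), rfl⟩
  choose r hr using h
  exact ⟨fun s => f (r s).1 (r s).2.1 (r s).2.2, fun a b c => eq_of_cons_cons_cons_eq h₁ h₂ (hr _)⟩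

end Sym

/-! ### Jets -/

section Jets

variable {R : Type*}

/-- The second derivatives of a 2-jet. -/
def second (p : JetCoord 2 → R) (m : Fin 2) (a b : Base) : R := p (c2 m a b)

theorem second_symm (p : JetCoord 2 → R) (m : Fin 2) (a b : Base) :
    second p m a b = second p m b a := by
  rw [second, second, c2, c2, Sym.cons_swap]

/-- The 2-jet whose coordinates of order at most one are those of `p` and whose second derivatives
are given by the symmetric function `F`. -/
noncomputable def withSecond (p : JetCoord 2 → R) (F : Fin 2 → Base → Base → R) : JetCoord 2 → R
  | Sum.inr (m, ⟨⟨2, _⟩, s⟩) => F m (symRep s).1 (symRep s).2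
  | c => p c

theorem withSecond_c2 (p : JetCoord 2 → R) {F : Fin 2 → Base → Base → R}
    (hF : ∀ m a b, F m a b = F m b a) (m : Fin 2) (a b : Base) :
    withSecond p F (c2 m a b) = F m a b :=
  eq_of_cons_cons_eq (hF m) (symRep_spec _)

theorem second_withSecond (p : JetCoord 2 → R) {F : Fin 2 → Base → Base → R}
    (hF : ∀ m a b, F m a b = F m b a) : second (withSecond p F) = F := by
  funext m a b
  exact withSecond_c2 p hF m a b

/-- A coordinate is a second derivative or of order at most one. -/
theorem eq_c2_or_withSecond (c : JetCoord 2) : (∃ m a b, c = c2 m a b) ∨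
    ∀ {R : Type _} (p : JetCoord 2 → R) (F : Fin 2 → Base → Base → R), withSecond p F c = p c := by
  rcases c with c | ⟨m, ⟨⟨j, hj⟩, s⟩⟩
  · exact Or.inr fun _ _ => rfl
  · match j, hj, s with
    | 0, _, _ => exact Or.inr fun _ _ => rfl
    | 1, _, _ => exact Or.inr fun _ _ => rfl
    | 2, _, s =>
      refine Or.inl ⟨m, (symRep s).1, (symRep s).2, ?_⟩
      rw [c2, symRep_spec]

theorem withSecond_second (p : JetCoord 2 → R) : withSecond p (second p) = p := by
  funext c
  rcases eq_c2_or_withSecond c with ⟨m, a, b, rfl⟩ | h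
  · exact withSecond_c2 p (second_symm p) m a b
  · exact h p _

/-- The third derivatives of a 3-jet. -/
def third (q : JetCoord 3 → R) (m : Fin 2) (a b c : Base) : R :=
  q (Sum.inr (m, ⟨⟨3, by decide⟩, a ::ₛ b ::ₛ c ::ₛ Sym.nil⟩))

theorem third_swap_left (q : JetCoord 3 → R) (m : Fin 2) (a b c : Base) :
    third q m a b c = third q m b a c := by
  rw [third, third, Sym.cons_swap]

theorem third_swap_right (q : JetCoord 3 → R) (m : Fin 2) (a b c : Base) :
    third q m a b c = third q m a c b := by
  rw [third, third, Sym.cons_swap b]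

/-- A 2-jet has a lift with prescribed third derivatives. -/
theorem exists_lift {K : Type*} (p : Jet K 2) {T : Fin 2 → Base → Base → Base → K}
    (h₁ : ∀ m a b c, T m a b c = T m b a c) (h₂ : ∀ m a b c, T m a b c = T m a c b) :
    ∃ q : Jet K 3, proj q = p ∧ third q = T := by
  choose g hg using fun m => exists_sym_three (h₁ m) (h₂ m)
  let q : Jet K 3 := fun c => match c with
    | Sum.inl a => p (Sum.inl a)
    | Sum.inr (m, ⟨⟨0, _⟩, s⟩) => p (Sum.inr (m, ⟨⟨0, by decide⟩, s⟩))
    | Sum.inr (m, ⟨⟨1, _⟩, s⟩) => p (Sum.inr (m, ⟨⟨1, by decide⟩, s⟩))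
    | Sum.inr (m, ⟨⟨2, _⟩, s⟩) => p (Sum.inr (m, ⟨⟨2, by decide⟩, s⟩))
    | Sum.inr (m, ⟨⟨3, _⟩, s⟩) => g m s
  refine ⟨q, ?_, ?_⟩
  · funext c
    rcases c with c | ⟨m, ⟨⟨j, hj⟩, s⟩⟩
    · rfl
    · match j, hj, s with
      | 0, _, _ => rfl
      | 1, _, _ => rfl
      | 2, _, _ => rfl
  · funext m a b c
    exact hg m a b c

end Jets

/-! ### The prolongation in terms of second and third derivatives -/

section Prolongation

variable {K : Type*} [Field K]

theorem symmetrise_eq {M : Type*} [AddCommMonoid M] (F : Fin 3 → Fin 3 → Fin 3 → M)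
    (t : Fin 3 → Fin 3) :
    symmetrise F t = F (t 0) (t 1) (t 2) + F (t 1) (t 0) (t 2) + F (t 1) (t 2) (t 0)
      + F (t 2) (t 1) (t 0) + F (t 2) (t 0) (t 1) + F (t 0) (t 2) (t 1) := by
  have h : (Finset.univ : Finset (Equiv.Perm (Fin 3))) =
      {1, Equiv.swap 0 1, Equiv.swap 0 2 * Equiv.swap 0 1, Equiv.swap 0 2,
        Equiv.swap 0 1 * Equiv.swap 0 2, Equiv.swap 1 2} := by decide
  rw [symmetrise, h]
  repeat rw [Finset.sum_insert (by decide)]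
  rw [Finset.sum_singleton]
  simp only [add_assoc]
  rfl

theorem totalDeriv_add {k : ℕ} (a : Base) (P Q : MvPolynomial (JetCoord k) K) (q : Jet K (k + 1)) :
    totalDeriv a (P + Q) q = totalDeriv a P q + totalDeriv a Q q := by
  simp only [totalDeriv, map_add, add_mul, Finset.sum_add_distrib]

theorem totalDeriv_sub {k : ℕ} (a : Base) (P Q : MvPolynomial (JetCoord k) K) (q : Jet K (k + 1)) :
    totalDeriv a (P - Q) q = totalDeriv a P q - totalDeriv a Q q := by
  simp only [totalDeriv, map_sub, sub_mul, Finset.sum_sub_distrib]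

theorem totalDeriv_mul {k : ℕ} (a : Base) (P Q : MvPolynomial (JetCoord k) K) (q : Jet K (k + 1)) :
    totalDeriv a (P * Q) q =
      totalDeriv a P q * eval (proj q) Q + eval (proj q) P * totalDeriv a Q q := by
  simp only [totalDeriv, Finset.sum_mul, Finset.mul_sum, ← Finset.sum_add_distrib]
  refine Finset.sum_congr rfl fun c _ => ?_
  simp only [Derivation.leibniz, map_add, smul_eq_mul, map_mul]
  ring

theorem totalDeriv_X {k : ℕ} (a : Base) (c : JetCoord k) (q : Jet K (k + 1)) :
    totalDeriv a (X c) q = totalDerivCoord a q c := by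
  classical
  rw [totalDeriv, Finset.sum_eq_single c]
  · simp
  · intro b _ hb
    rw [pderiv_X_of_ne hb.symm, map_zero, zero_mul]
  · simp

theorem totalDerivCoord_c1 (a : Base) (q : Jet K 3) (m : Fin 2) (b : Base) :
    totalDerivCoord a q (c1 m b) = second (proj q) m a b := rfl

theorem totalDerivCoord_c2 (a : Base) (q : Jet K 3) (m : Fin 2) (b c : Base) :
    totalDerivCoord a q (c2 m b c) = third q m a b c := rfl

/-- The coefficients `f_{u_k} - h_{v_k}`. -/
def coeffP {R : Type*} [Ring R] (p : JetCoord 2 → R) (k : Fin 3) : R :=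
  p (c1 0 (u k)) - p (c1 1 (v k))

/-- The coefficients `f_{v_k}`. -/
def coeffQ {R : Type*} (p : JetCoord 2 → R) (k : Fin 3) : R := p (c1 0 (v k))

/-- The coefficients `h_{u_k}`. -/
def coeffR {R : Type*} (p : JetCoord 2 → R) (k : Fin 3) : R := p (c1 1 (u k))

theorem eval_linDegEq (p : Jet K 2) (l : Fin 2) (t : Fin 3 → Fin 3) :
    eval p (linDegEq K l t) =
      2 * symExpr l (coeffP p) (coeffQ p) (coeffR p) (second p) (t 0) (t 1) (t 2) := by
  have h₀ : ∀ i j k, eval p (firstExpr K i j k) =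
      expr 0 (coeffP p) (coeffQ p) (coeffR p) (second p) i j k := fun i j k => by
    simp [firstExpr, expr, coeffP, coeffQ, coeffR, second]
  have h₁ : ∀ i j k, eval p (secondExpr K i j k) =
      expr 1 (coeffP p) (coeffQ p) (coeffR p) (second p) i j k := fun i j k => by
    simp [secondExpr, expr, coeffP, coeffQ, coeffR, second]
  fin_cases l <;>
    simp only [linDegEq, symmetrise_eq, symExpr, map_add, h₀, h₁, Fin.zero_eta, Fin.mk_one,
      reduceIte, one_ne_zero, expr_swap _ _ _ _ (second_symm p) (t 1) (t 0),
      expr_swap _ _ _ _ (second_symm p) (t 2) (t 1),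
      expr_swap _ _ _ _ (second_symm p) (t 0) (t 2)] <;>
    ring

theorem totalDeriv_linDegEq (q : Jet K 3) (l : Fin 2) (t : Fin 3 → Fin 3) (a : Base) :
    totalDeriv a (linDegEq K l t) q =
      2 * (symExpr l (coeffP (proj q)) (coeffQ (proj q)) (coeffR (proj q))
        (fun m => third q m a) (t 0) (t 1) (t 2)
        + quadExpr (second (proj q)) l (t 0) (t 1) (t 2) a) := by
  have h₀ : ∀ i j k, totalDeriv a (firstExpr K i j k) q =
      expr 0 (coeffP (proj q)) (coeffQ (proj q)) (coeffR (proj q)) (fun m => third q m a) i j k +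
      expr 0 (fun n => second (proj q) 0 a (u n) - second (proj q) 1 a (v n))
        (fun n => second (proj q) 0 a (v n)) (fun n => second (proj q) 1 a (u n))
        (second (proj q)) i j k := fun i j k => by
    simp only [firstExpr, totalDeriv_add, totalDeriv_sub, totalDeriv_mul, totalDeriv_X, eval_X,
      totalDerivCoord_c1, totalDerivCoord_c2, map_add, map_sub, expr, reduceIte, coeffP, coeffQ,
      coeffR]
    simp only [second]
    ring
  have h₁ : ∀ i j k, totalDeriv a (secondExpr K i j k) q =
      expr 1 (coeffP (proj q)) (coeffQ (proj q)) (coeffR (proj q)) (fun m => third q m a) i j k +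
      expr 1 (fun n => second (proj q) 0 a (u n) - second (proj q) 1 a (v n))
        (fun n => second (proj q) 0 a (v n)) (fun n => second (proj q) 1 a (u n))
        (second (proj q)) i j k := fun i j k => by
    simp only [secondExpr, totalDeriv_add, totalDeriv_sub, totalDeriv_mul, totalDeriv_X, eval_X,
      totalDerivCoord_c1, totalDerivCoord_c2, map_add, map_sub, expr, reduceIte, one_ne_zero,
      coeffP, coeffQ, coeffR]
    simp only [second]
    ring
  have h₂ : ∀ m b c, third q m a b c = third q m a c b := fun m b c => third_swap_right q m a b c
  fin_cases l <;>
    simp only [linDegEq, symmetrise_eq, symExpr, quadExpr, totalDeriv_add, h₀, h₁, Fin.zero_eta,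
      Fin.mk_one, reduceIte, one_ne_zero,
      expr_swap _ _ _ _ (second_symm (proj q)) (t 1) (t 0),
      expr_swap _ _ _ _ (second_symm (proj q)) (t 2) (t 1),
      expr_swap _ _ _ _ (second_symm (proj q)) (t 0) (t 2),
      expr_swap _ _ _ _ h₂ (t 1) (t 0), expr_swap _ _ _ _ h₂ (t 2) (t 1),
      expr_swap _ _ _ _ h₂ (t 0) (t 2)] <;>
    ring

theorem mem_prolongation_iff [CharZero K] (q : Jet K 3) :
    q ∈ prolongation K ↔
      (∀ l i j k, symExpr l (coeffP (proj q)) (coeffQ (proj q)) (coeffR (proj q))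
        (second (proj q)) i j k = 0) ∧
      ∀ l i j k a, symExpr l (coeffP (proj q)) (coeffQ (proj q)) (coeffR (proj q))
        (fun m => third q m a) i j k + quadExpr (second (proj q)) l i j k a = 0 := by
  constructor
  · intro h
    refine ⟨fun l i j k => ?_, fun l i j k a => ?_⟩
    · have := (h l ![i, j, k]).1
      rw [eval_linDegEq] at this
      exact (mul_eq_zero.1 this).resolve_left two_ne_zero
    · have := (h l ![i, j, k]).2 a
      rw [totalDeriv_linDegEq] at this
      exact (mul_eq_zero.1 this).resolve_left two_ne_zero
  · rintro ⟨h₁, h₂⟩ l t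
    refine ⟨?_, fun a => ?_⟩
    · rw [eval_linDegEq, h₁, mul_zero]
    · rw [totalDeriv_linDegEq, h₂, mul_zero]

end Prolongation

end LinDeg

namespace LinDeg

open MvPolynomial

/-! ### Linear changes of the indices of the independent variables -/

section BaseChange

variable {R : Type*} [CommRing R]

/-- The action of a matrix on a function of the independent variables, through their indices. -/
def act (M : Matrix (Fin 3) (Fin 3) R) (g : Base → R) : Base → R :=
  Sum.elim (fun j => ∑ i, M j i * g (u i)) (fun j => ∑ i, M j i * g (v i))

theorem act_mul (M N : Matrix (Fin 3) (Fin 3) R) (g : Base → R) :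
    act M (act N g) = act (M * N) g := by
  funext a
  rcases a with a | a <;>
    simp only [act, Sum.elim_inl, Sum.elim_inr, Matrix.mul_apply, Fin.sum_univ_three] <;> ring

theorem act_smul_one (r : R) (g : Base → R) (a : Base) :
    act (r • (1 : Matrix (Fin 3) (Fin 3) R)) g a = r * g a := by
  rcases a with a | a <;> fin_cases a <;> simp [act, Fin.sum_univ_three]

theorem act_comm (M N : Matrix (Fin 3) (Fin 3) R) (g : Base → Base → R) (a b : Base) :
    act M (fun a' => act N (g a') b) a = act N (fun b' => act M (fun a' => g a' b') a) b := by
  rcases a with a | a <;> rcases b with b | b <;>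
    simp only [act, Sum.elim_inl, Sum.elim_inr, Fin.sum_univ_three] <;> ring

/-- The action of a matrix on second derivatives. -/
def act₂ (M : Matrix (Fin 3) (Fin 3) R) (F : Fin 2 → Base → Base → R) (m : Fin 2)
    (a b : Base) : R :=
  act M (fun a' => act M (F m a') b) a

/-- The action of a matrix on third derivatives. -/
def act₃ (M : Matrix (Fin 3) (Fin 3) R) (T : Fin 2 → Base → Base → Base → R) (m : Fin 2)
    (a b c : Base) : R :=
  act M (fun a' => act₂ M (fun m => T m a') m b c) a

theorem act₂_symm (M : Matrix (Fin 3) (Fin 3) R) {F : Fin 2 → Base → Base → R}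
    (hF : ∀ m a b, F m a b = F m b a) (m : Fin 2) (a b : Base) :
    act₂ M F m a b = act₂ M F m b a := by
  rw [act₂, act_comm]
  simp only [hF m _, act₂]

theorem act₂_mul (M N : Matrix (Fin 3) (Fin 3) R) (F : Fin 2 → Base → Base → R) :
    act₂ M (act₂ N F) = act₂ (M * N) F := by
  funext m a b
  have h : (fun a' => act M (act₂ N F m a') b) =
      act N (fun a'' => act M (act N (F m a'')) b) :=
    funext fun a' => (act_comm N M (fun a'' => act N (F m a'')) a' b).symm
  rw [act₂, h, act_mul]
  simp only [act_mul, act₂]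

theorem act₂_smul_one (r : R) (F : Fin 2 → Base → Base → R) (m : Fin 2) (a b : Base) :
    act₂ (r • (1 : Matrix (Fin 3) (Fin 3) R)) F m a b = r ^ 2 * F m a b := by
  rw [act₂, act_smul_one, act_smul_one]
  ring

theorem act₂_one (F : Fin 2 → Base → Base → R) : act₂ 1 F = F := by
  funext m a b
  have := act₂_smul_one 1 F m a b
  rwa [one_smul, one_pow, one_mul] at this

theorem act₃_swap_right (M : Matrix (Fin 3) (Fin 3) R) {T : Fin 2 → Base → Base → Base → R}
    (h₂ : ∀ m a b c, T m a b c = T m a c b) (m : Fin 2) (a b c : Base) :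
    act₃ M T m a b c = act₃ M T m a c b := by
  simp only [act₃, act₂_symm M (fun m b c => h₂ m _ b c) m b c]

theorem act₃_swap_left (M : Matrix (Fin 3) (Fin 3) R) {T : Fin 2 → Base → Base → Base → R}
    (h₁ : ∀ m a b c, T m a b c = T m b a c) (m : Fin 2) (a b c : Base) :
    act₃ M T m a b c = act₃ M T m b a c := by
  simp only [act₃, act₂]
  rw [act_comm M M (fun a' b' => act M (T m a' b') c)]
  refine congrArg (fun g => act M g b) (funext fun b' => congrArg (fun g => act M g a)
    (funext fun a' => congrArg (fun g => act M g c) (funext fun c' => h₁ m a' b' c')))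

theorem act₃_eq (M : Matrix (Fin 3) (Fin 3) R) (T : Fin 2 → Base → Base → Base → R) (a : Base) :
    (fun m => act₃ M T m a) = act₂ M (fun m b c => act M (fun a' => T m a' b c) a) := by
  funext m b c
  simp only [act₃, act₂]
  rw [act_comm]
  refine congrArg (fun g => act M g b) (funext fun b' => ?_)
  rw [act_comm]

theorem map_act {S : Type*} [CommRing S] (f : R →+* S) (M : Matrix (Fin 3) (Fin 3) R)
    (g : Base → R) (a : Base) : f (act M g a) = act (M.map f) (fun b => f (g b)) a := by
  rcases a with a | a <;> simp [act]

theorem map_act₂ {S : Type*} [CommRing S] (f : R →+* S) (M : Matrix (Fin 3) (Fin 3) R)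
    (F : Fin 2 → Base → Base → R) (m : Fin 2) (a b : Base) :
    f (act₂ M F m a b) = act₂ (M.map f) (fun m a b => f (F m a b)) m a b := by
  simp only [act₂, map_act]

end BaseChange

section Covariance

variable {K : Type*} [Field K]

theorem expr_act (M : Matrix (Fin 3) (Fin 3) K) (l : Fin 2) (P Q R : Fin 3 → K)
    (F : Fin 2 → Base → Base → K) (i j k : Fin 3) :
    expr l (M.mulVec P) (M.mulVec Q) (M.mulVec R) (act₂ M F) i j k =
      ∑ i', ∑ j', ∑ k', M i i' * M j j' * M k k' * expr l P Q R F i' j' k' := by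
  fin_cases l <;>
    simp only [expr, Fin.zero_eta, Fin.mk_one, reduceIte, one_ne_zero, Matrix.mulVec, dotProduct,
      act₂, act, Sum.elim_inl, Sum.elim_inr, Fin.sum_univ_three] <;> ring

theorem symExpr_act (M : Matrix (Fin 3) (Fin 3) K) (l : Fin 2) (P Q R : Fin 3 → K)
    (F : Fin 2 → Base → Base → K) (i j k : Fin 3) :
    symExpr l (M.mulVec P) (M.mulVec Q) (M.mulVec R) (act₂ M F) i j k =
      ∑ i', ∑ j', ∑ k', M i i' * M j j' * M k k' * symExpr l P Q R F i' j' k' := by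
  simp only [symExpr, expr_act]
  simp only [Fin.sum_univ_three]
  ring

theorem symExpr_act_third (M : Matrix (Fin 3) (Fin 3) K) (l : Fin 2) (P Q R : Fin 3 → K)
    (T : Fin 2 → Base → Base → Base → K) (i j k : Fin 3) (a : Base) :
    symExpr l P Q R (fun m b c => act M (fun a' => T m a' b c) a) i j k =
      act M (fun a' => symExpr l P Q R (fun m => T m a') i j k) a := by
  rcases a with a | a <;> fin_cases l <;>
    simp only [symExpr, expr, Fin.zero_eta, Fin.mk_one, reduceIte, one_ne_zero,
      act, Sum.elim_inl, Sum.elim_inr, Fin.sum_univ_three] <;> ring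

theorem quadExpr_act (M : Matrix (Fin 3) (Fin 3) K) (l : Fin 2)
    (F : Fin 2 → Base → Base → K) (i j k : Fin 3) (a : Base) :
    quadExpr (act₂ M F) l i j k a =
      ∑ i', ∑ j', ∑ k', M i i' * M j j' * M k k' * act M (quadExpr F l i' j' k') a := by
  have hP : (fun n => act₂ M F 0 a (u n) - act₂ M F 1 a (v n)) =
      M.mulVec fun n => act M (fun a' => F 0 a' (u n) - F 1 a' (v n)) a := by
    funext n
    rcases a with a | a <;>
      simp only [act₂, act, Matrix.mulVec, dotProduct, Sum.elim_inl, Sum.elim_inr,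
        Fin.sum_univ_three] <;> ring
  have hQ : (fun n => act₂ M F 0 a (v n)) = M.mulVec fun n => act M (fun a' => F 0 a' (v n)) a := by
    funext n
    rcases a with a | a <;>
      simp only [act₂, act, Matrix.mulVec, dotProduct, Sum.elim_inl, Sum.elim_inr,
        Fin.sum_univ_three] <;> ring
  have hR : (fun n => act₂ M F 1 a (u n)) = M.mulVec fun n => act M (fun a' => F 1 a' (u n)) a := by
    funext n
    rcases a with a | a <;>
      simp only [act₂, act, Matrix.mulVec, dotProduct, Sum.elim_inl, Sum.elim_inr,
        Fin.sum_univ_three] <;> ring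
  rw [quadExpr, hP, hQ, hR, symExpr_act]
  refine Finset.sum_congr rfl fun i' _ => Finset.sum_congr rfl fun j' _ =>
    Finset.sum_congr rfl fun k' _ => congrArg (M i i' * M j j' * M k k' * ·) ?_
  rcases a with a | a <;> fin_cases l <;>
    simp only [quadExpr, symExpr, expr, Fin.zero_eta, Fin.mk_one, reduceIte, one_ne_zero,
      act, Sum.elim_inl, Sum.elim_inr, Fin.sum_univ_three] <;> ring

/-- The conditions of linear degeneracy and their derivatives are preserved by linear changes of the
indices of the independent variables. -/
theorem symExpr_act_eq_zero (M : Matrix (Fin 3) (Fin 3) K) {P Q R : Fin 3 → K}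
    {F : Fin 2 → Base → Base → K} (h : ∀ l i j k, symExpr l P Q R F i j k = 0)
    (l : Fin 2) (i j k : Fin 3) :
    symExpr l (M.mulVec P) (M.mulVec Q) (M.mulVec R) (act₂ M F) i j k = 0 := by
  simp [symExpr_act, h]

theorem symExpr_add_quadExpr_act_eq_zero (M : Matrix (Fin 3) (Fin 3) K) {P Q R : Fin 3 → K}
    {F : Fin 2 → Base → Base → K} {T : Fin 2 → Base → Base → Base → K}
    (h : ∀ l i j k a, symExpr l P Q R (fun m => T m a) i j k + quadExpr F l i j k a = 0)
    (l : Fin 2) (i j k : Fin 3) (a : Base) :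
    symExpr l (M.mulVec P) (M.mulVec Q) (M.mulVec R) (fun m => act₃ M T m a) i j k +
      quadExpr (act₂ M F) l i j k a = 0 := by
  rw [act₃_eq, symExpr_act, quadExpr_act]
  simp only [symExpr_act_third, ← Finset.sum_add_distrib, ← mul_add]
  refine Finset.sum_eq_zero fun i' _ => Finset.sum_eq_zero fun j' _ =>
    Finset.sum_eq_zero fun k' _ => mul_eq_zero_of_right _ ?_
  have h' := fun a' => eq_neg_of_add_eq_zero_left (h l i' j' k' a')
  simp only [h']
  rcases a with a | a <;> simp only [act, Sum.elim_inl, Sum.elim_inr, Fin.sum_univ_three] <;> ring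

end Covariance

/-! ### The chart -/

section Chart

/-- The matrix with columns `f_{v_k}`, `h_{v_k} - f_{u_k}`, `-h_{u_k}`. -/
def coeffMatrix {R : Type*} [CommRing R] (p : JetCoord 2 → R) : Matrix (Fin 3) (Fin 3) R :=
  Matrix.of fun i => ![coeffQ p i, -coeffP p i, -coeffR p i]

theorem coeffMatrix_withSecond {R : Type*} [CommRing R] (p : JetCoord 2 → R)
    (F : Fin 2 → Base → Base → R) : coeffMatrix (withSecond p F) = coeffMatrix p := rfl

theorem map_coeffMatrix {R S : Type*} [CommRing R] [CommRing S] (f : R →+* S)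
    (p : JetCoord 2 → R) : (coeffMatrix p).map f = coeffMatrix (fun c => f (p c)) := by
  ext i j
  fin_cases j <;> simp [coeffMatrix, coeffP, coeffQ, coeffR]

theorem map_withSecond {R S : Type*} (f : R → S) (p : JetCoord 2 → R)
    (F : Fin 2 → Base → Base → R) (c : JetCoord 2) :
    f (withSecond p F c) = withSecond (fun c => f (p c)) (fun m a b => f (F m a b)) c := by
  rcases c with c | ⟨m, ⟨⟨j, hj⟩, s⟩⟩
  · rfl
  · match j, hj, s with
    | 0, _, _ => rfl
    | 1, _, _ => rfl
    | 2, _, _ => rfl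

variable (K : Type*) [Field K]

theorem det_charMatrix [CharZero K] (p : Jet K 2) :
    (charMatrix p).det = (1 / 4 * (coeffMatrix p).det) ^ 2 := by
  let B : Matrix (Fin 4) (Fin 4) K := Matrix.of ![
    Fin.snoc (fun i : Fin 3 => -p (c1 0 (u i))) 1, Fin.snoc (fun i : Fin 3 => -p (c1 0 (v i))) 0,
    Fin.snoc (fun i : Fin 3 => -p (c1 1 (u i))) 0, Fin.snoc (fun i : Fin 3 => -p (c1 1 (v i))) 1]
  let J : Matrix (Fin 4) (Fin 4) K :=
    !![0, 0, 0, 1 / 2; 0, 0, -1 / 2, 0; 0, -1 / 2, 0, 0; 1 / 2, 0, 0, 0]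
  have h : charMatrix p = B.transpose * J * B := by
    ext i j
    simp only [charMatrix, Matrix.of_apply, Matrix.mul_apply, Fin.sum_univ_four,
      Matrix.transpose_apply, B, J, Matrix.cons_val]
    simp
    ring
  have hJ : J.det = 1 / 16 := by
    simp [J, Matrix.det_succ_row_zero, Fin.sum_univ_succ, Fin.succAbove]
    norm_num
  have hB : B.det = (coeffMatrix p).det := by
    rw [Matrix.det_fin_three, Matrix.det_succ_column B 3]
    simp [B, Fin.sum_univ_four, Matrix.det_fin_three, Matrix.submatrix_apply, Fin.succAbove,
      Fin.snoc, coeffMatrix, coeffP, coeffQ, coeffR]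
    rw [show Fin.castPred (2 : Fin 4) (by decide) = (2 : Fin 3) from rfl]
    ring
  rw [h, Matrix.det_mul, Matrix.det_mul, Matrix.det_transpose, hJ]
  rw [hB]
  ring

end Chart

end LinDeg

namespace LinDeg

open MvPolynomial

section Locus

theorem withSecond_withSecond {R : Type*} (p : JetCoord 2 → R) (F G : Fin 2 → Base → Base → R) :
    withSecond (withSecond p F) G = withSecond p G := by
  funext c
  rcases c with c | ⟨m, ⟨⟨j, hj⟩, s⟩⟩
  · rfl
  · match j, hj, s with
    | 0, _, _ => rfl
    | 1, _, _ => rfl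
    | 2, _, _ => rfl

variable (K : Type*) [Field K]

/-- The 2-jet obtained from `p` by acting on its second derivatives by its coefficient matrix. -/
noncomputable def twist {R : Type*} [CommRing R] (p : JetCoord 2 → R) : JetCoord 2 → R :=
  withSecond p (act₂ (coeffMatrix p) (second p))

variable {K} in
theorem eval_twist (x : Jet K 2) :
    (fun c => eval x (twist (X : JetCoord 2 → MvPolynomial (JetCoord 2) K) c)) = twist x := by
  funext c
  have hM := map_coeffMatrix (eval x) (X : JetCoord 2 → MvPolynomial (JetCoord 2) K)
  simp only [eval_X] at hM
  rw [twist, map_withSecond (eval x)]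
  simp only [map_act₂, hM, second, eval_X, twist]
  rfl

variable {K} in
theorem eval_det_coeffMatrix (x : Jet K 2) :
    eval x (coeffMatrix (X : JetCoord 2 → MvPolynomial (JetCoord 2) K)).det =
      (coeffMatrix x).det := by
  rw [RingHom.map_det, RingHom.mapMatrix_apply, map_coeffMatrix]
  simp only [eval_X]

variable {K} in
theorem second_twist (x : Jet K 2) : second (twist x) = act₂ (coeffMatrix x) (second x) :=
  second_withSecond x (act₂_symm _ (second_symm x))

variable {K} in
theorem coeffMatrix_twist (x : Jet K 2) : coeffMatrix (twist x) = coeffMatrix x := rfl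

/-- The chart of the space of non-degenerate 2-jets in which the conditions of linear degeneracy
have constant coefficients. -/
noncomputable def chart : PolyChart (JetCoord 2) K where
  toPoly := twist X
  inv := withSecond (fun c => (coeffMatrix X).det ^ 2 * X c)
    (act₂ (coeffMatrix X).adjugate (second X))
  den := (coeffMatrix X).det ^ 2
  map_den x hx := by
    rw [eval_twist, map_pow, eval_det_coeffMatrix, coeffMatrix_twist]
    rwa [map_pow, eval_det_coeffMatrix] at hx
  surj y hy := by
    rw [map_pow, eval_det_coeffMatrix] at hy
    refine ⟨withSecond y (act₂ (coeffMatrix y)⁻¹ (second y)), ?_, ?_⟩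
    · rwa [map_pow, eval_det_coeffMatrix, coeffMatrix_withSecond]
    · have hu : IsUnit (coeffMatrix y).det :=
        isUnit_iff_ne_zero.2 (pow_ne_zero_iff two_ne_zero |>.1 hy)
      rw [eval_twist, twist, coeffMatrix_withSecond, withSecond_withSecond,
        second_withSecond _ (act₂_symm _ (second_symm y)), act₂_mul, Matrix.mul_nonsing_inv _ hu,
        act₂_one, withSecond_second]
  eval_inv x hx c := by
    rw [eval_twist, map_pow, eval_det_coeffMatrix, coeffMatrix_twist, map_withSecond (eval _)]
    have hM : (coeffMatrix (X : JetCoord 2 → MvPolynomial (JetCoord 2) K)).adjugate.map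
        (eval (twist x)) = (coeffMatrix x).adjugate := by
      rw [← RingHom.mapMatrix_apply, RingHom.map_adjugate, RingHom.mapMatrix_apply,
        map_coeffMatrix]
      simp only [eval_X, coeffMatrix_twist]
    have hF : (fun m a b => act₂ (coeffMatrix x).adjugate
        (fun m a b => eval (twist x) (second (X : JetCoord 2 → MvPolynomial (JetCoord 2) K) m a b))
        m a b) = fun m a b => (coeffMatrix x).det ^ 2 * second x m a b := by
      have : (fun m a b => eval (twist x)
          (second (X : JetCoord 2 → MvPolynomial (JetCoord 2) K) m a b)) = second (twist x) := by
        funext m a b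
        exact eval_X _
      rw [this, second_twist, act₂_mul, Matrix.adjugate_mul]
      funext m a b
      rw [act₂_smul_one]
    simp only [map_act₂, hM]
    rw [hF]
    simp only [map_mul, map_pow, eval_det_coeffMatrix, coeffMatrix_twist, eval_X]
    rw [twist]
    have := map_withSecond (fun r => (coeffMatrix x).det ^ 2 * r) x (second x) c
    rw [withSecond_second] at this
    rw [this]
    rcases eq_c2_or_withSecond c with ⟨m, a, b, rfl⟩ | h
    · rfl
    · rw [h, h, h]

variable {K}

theorem chart_map (x : Jet K 2) : (chart K).map x = twist x := eval_twist x

theorem mem_dom_chart {x : Jet K 2} : x ∈ (chart K).dom ↔ (coeffMatrix x).det ≠ 0 := by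
  change eval x ((coeffMatrix X).det ^ 2) ≠ 0 ↔ _
  rw [map_pow, eval_det_coeffMatrix, pow_ne_zero_iff two_ne_zero]

theorem dom_chart [CharZero K] : (chart K).dom = nondegenerate K := by
  ext x
  rw [mem_dom_chart, nondegenerate, Set.mem_ofPred_eq, det_charMatrix, pow_ne_zero_iff two_ne_zero,
    mul_ne_zero_iff]
  exact (and_iff_right (by norm_num)).symm

variable (K) in
/-- The 2-jet of `f = v₁ - u₂`, `h = -u₃` at the origin. -/
def origin : Jet K 2 :=
  Pi.single (c1 0 (v 0)) 1 - Pi.single (c1 0 (u 1)) 1 - Pi.single (c1 1 (u 2)) 1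

theorem c1_inj {m n : Fin 2} {a b : Base} : c1 m a = c1 n b ↔ m = n ∧ a = b := by
  simp [c1]

theorem coeffMatrix_origin : coeffMatrix (origin K) = 1 := by
  ext i j
  fin_cases i <;> fin_cases j <;>
    simp [coeffMatrix, coeffP, coeffQ, coeffR, origin, Pi.single_apply, c1_inj]

theorem second_origin : second (origin K) = 0 := by
  funext m a b
  simp [second, origin, c1, c2]

theorem origin_mem_dom_chart : origin K ∈ (chart K).dom := by
  rw [mem_dom_chart, coeffMatrix_origin, Matrix.det_one]
  exact one_ne_zero

variable (K) in
/-- The linear conditions on 2-jets that describe the second-order locus in the chart. -/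
def conditions : Jet K 2 →ₗ[K] ((Fin 2 × Fin 10) ⊕ (Fin 2 × Fin 5) ⊕ Fin 4 → K) where
  toFun p := Sum.elim
    (fun s => stdExpr s.1 (second p) (triple s.2).1 (triple s.2).2.1 (triple s.2).2.2)
    (Sum.elim (fun s => quarticPart (second p) s.1 s.2) (cubicPart (second p)))
  map_add' p q := by
    have h : second (p + q) = second p + second q := rfl
    funext s
    rcases s with s | s | s <;> simp [h, stdExpr_add, quarticPart_add, cubicPart_add]
  map_smul' r p := by
    have h : second (r • p) = r • second p := rfl
    funext s
    rcases s with s | s | s <;> simp [h, stdExpr_smul, quarticPart_smul, cubicPart_smul]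

theorem conditions_surjective [CharZero K] : Function.Surjective (conditions K) := by
  intro c
  obtain ⟨F, hF, h₁, h₂, h₃⟩ := exists_stdExpr_quarticPart_cubicPart
    (fun l s => c (Sum.inl (l, s))) (fun q j => c (Sum.inr (Sum.inl (q, j))))
    (fun i => c (Sum.inr (Sum.inr i)))
  refine ⟨withSecond 0 F, ?_⟩
  funext s
  simp only [conditions, LinearMap.coe_mk, AddHom.coe_mk, second_withSecond 0 hF, h₁, h₂, h₃]
  rcases s with s | s | s <;> rfl

variable (K) in
/-- The conditions that cut out the component on which the cubic part vanishes. -/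
def cubicConditions : Jet K 2 →ₗ[K] ((Fin 2 × Fin 10) ⊕ Fin 4 → K) :=
  LinearMap.funLeft K K (Sum.map id Sum.inr) ∘ₗ conditions K

variable (K) in
/-- The conditions that cut out the component on which the quartic part vanishes. -/
def quarticConditions : Jet K 2 →ₗ[K] ((Fin 2 × Fin 10) ⊕ (Fin 2 × Fin 5) → K) :=
  LinearMap.funLeft K K (Sum.map id Sum.inl) ∘ₗ conditions K

theorem cubicConditions_surjective [CharZero K] : Function.Surjective (cubicConditions K) :=
  (LinearMap.funLeft_surjective_of_injective K K _
    (Function.injective_id.sumMap Sum.inr_injective)).comp conditions_surjective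

theorem quarticConditions_surjective [CharZero K] : Function.Surjective (quarticConditions K) :=
  (LinearMap.funLeft_surjective_of_injective K K _
    (Function.injective_id.sumMap Sum.inl_injective)).comp conditions_surjective

theorem ker_conditions :
    LinearMap.ker (conditions K) =
      LinearMap.ker (cubicConditions K) ⊓ LinearMap.ker (quarticConditions K) := by
  ext p
  simp only [Submodule.mem_inf, LinearMap.mem_ker, cubicConditions, quarticConditions,
    LinearMap.comp_apply]
  refine ⟨fun h => by simp [h], fun ⟨h₁, h₂⟩ => ?_⟩
  funext s
  rcases s with s | s | s
  · exact congrFun h₁ (Sum.inl s)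
  · exact congrFun h₂ (Sum.inr s)
  · exact congrFun h₁ (Sum.inr s)

theorem forall_stdExpr_eq_zero_iff {F : Fin 2 → Base → Base → K}
    (hF : ∀ m a b, F m a b = F m b a) :
    (∀ l i j k, stdExpr l F i j k = 0) ↔
      ∀ l s, stdExpr l F (triple s).1 (triple s).2.1 (triple s).2.2 = 0 := by
  refine ⟨fun h l s => h l _ _ _, fun h l => ?_⟩
  refine forall_of_ordered (p := fun i j k => stdExpr l F i j k = 0)
    (fun i j k H => ?_) (fun i j k H => ?_) (h l 0) (h l 1) (h l 2) (h l 3) (h l 4) (h l 5)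
    (h l 6) (h l 7) (h l 8) (h l 9)
  · rw [← H, stdExpr, stdExpr, symExpr_swap _ _ _ _ hF]
  · rw [← H, stdExpr, stdExpr, ← symExpr_rotate]

theorem second_sub_origin (x : Jet K 2) : second (x - origin K) = second x := by
  have h : second (x - origin K) = second x - second (origin K) := rfl
  rw [h, second_origin, sub_zero]

theorem mem_ker_cubicConditions (x : Jet K 2) :
    x - origin K ∈ LinearMap.ker (cubicConditions K) ↔
      (∀ l i j k, stdExpr l (second x) i j k = 0) ∧ cubicPart (second x) = 0 := by
  rw [forall_stdExpr_eq_zero_iff (second_symm x), LinearMap.mem_ker, ← second_sub_origin x]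
  constructor
  · intro h
    exact ⟨fun l s => congrFun h (Sum.inl (l, s)), funext fun i => congrFun h (Sum.inr i)⟩
  · rintro ⟨h₁, h₂⟩
    funext s
    rcases s with s | s
    · exact h₁ s.1 s.2
    · exact congrFun h₂ s

theorem mem_ker_quarticConditions (x : Jet K 2) :
    x - origin K ∈ LinearMap.ker (quarticConditions K) ↔
      (∀ l i j k, stdExpr l (second x) i j k = 0) ∧ quarticPart (second x) = 0 := by
  rw [forall_stdExpr_eq_zero_iff (second_symm x), LinearMap.mem_ker, ← second_sub_origin x]
  constructor
  · intro h
    exact ⟨fun l s => congrFun h (Sum.inl (l, s)),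
      funext fun q => funext fun j => congrFun h (Sum.inr (q, j))⟩
  · rintro ⟨h₁, h₂⟩
    funext s
    rcases s with s | s
    · exact h₁ s.1 s.2
    · exact congrFun (congrFun h₂ s.1) s.2

theorem mulVec_coeffMatrix (p : Jet K 2) :
    (coeffMatrix p).mulVec ![0, -1, 0] = coeffP p ∧ (coeffMatrix p).mulVec ![1, 0, 0] = coeffQ p ∧
      (coeffMatrix p).mulVec ![0, 0, -1] = coeffR p := by
  refine ⟨?_, ?_, ?_⟩ <;> funext i <;>
    simp [coeffMatrix, Matrix.mulVec, dotProduct, Fin.sum_univ_three]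

/-- In the chart, a non-degenerate 2-jet lifts to the prolongation if and only if its second
derivatives solve the conditions with standard coefficients, and one of the two parts vanishes. -/
theorem twist_mem_proj_prolongation_iff [CharZero K] {x : Jet K 2} (hx : (coeffMatrix x).det ≠ 0) :
    twist x ∈ proj '' prolongation K ↔ (∀ l i j k, stdExpr l (second x) i j k = 0) ∧
      (cubicPart (second x) = 0 ∨ quarticPart (second x) = 0) := by
  obtain ⟨hP, hQ, hR⟩ := mulVec_coeffMatrix x
  have hu : IsUnit (coeffMatrix x).det := isUnit_iff_ne_zero.2 hx
  have hP' : coeffP (twist x) = coeffP x := rfl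
  have hQ' : coeffQ (twist x) = coeffQ x := rfl
  have hR' : coeffR (twist x) = coeffR x := rfl
  constructor
  · rintro ⟨q, hq, hqx⟩
    rw [mem_prolongation_iff, hqx, hP', hQ', hR', second_twist] at hq
    have hv (w : Fin 3 → K) : (coeffMatrix x)⁻¹.mulVec ((coeffMatrix x).mulVec w) = w := by
      rw [Matrix.mulVec_mulVec, Matrix.nonsing_inv_mul _ hu, Matrix.one_mulVec]
    have h₁ := symExpr_act_eq_zero (coeffMatrix x)⁻¹ hq.1
    have h₂ := symExpr_add_quadExpr_act_eq_zero (coeffMatrix x)⁻¹ hq.2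
    rw [← hP, ← hQ, ← hR, act₂_mul, Matrix.nonsing_inv_mul _ hu, act₂_one, hv, hv, hv] at h₁ h₂
    exact ⟨h₁, cubicPart_eq_zero_or_quarticPart_eq_zero (second_symm x)
      (act₃_swap_left _ (third_swap_left q)) (act₃_swap_right _ (third_swap_right q)) h₁ h₂⟩
  · rintro ⟨h, hab⟩
    obtain ⟨T, hT₁, hT₂, hT⟩ := exists_third_derivatives (second_symm x) h hab
    obtain ⟨q, hq, hq'⟩ := exists_lift (twist x) (act₃_swap_left (coeffMatrix x) hT₁)
      (act₃_swap_right (coeffMatrix x) hT₂)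
    refine ⟨q, ?_, hq⟩
    rw [mem_prolongation_iff, hq, hq', hP', hQ', hR', second_twist, ← hP, ← hQ, ← hR]
    exact ⟨symExpr_act_eq_zero _ h, symExpr_add_quadExpr_act_eq_zero _ hT⟩

theorem secondOrderLocus_eq [CharZero K] :
    secondOrderLocus K = (chart K).image (origin K) (LinearMap.ker (cubicConditions K)) ∪
      (chart K).image (origin K) (LinearMap.ker (quarticConditions K)) := by
  rw [PolyChart.image, PolyChart.image, ← Set.image_union]
  ext y
  simp only [Set.mem_image, Set.mem_union, Set.mem_ofPred_eq, ← and_or_left,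
    mem_ker_cubicConditions, mem_ker_quarticConditions, chart_map, mem_dom_chart]
  constructor
  · rintro ⟨hy, hnd⟩
    rw [← dom_chart] at hnd
    obtain ⟨x, hx, rfl⟩ := (chart K).surj y hnd
    change x ∈ (chart K).dom at hx
    rw [mem_dom_chart] at hx
    erw [eval_twist] at hy
    exact ⟨x, ⟨hx, (twist_mem_proj_prolongation_iff hx).1 hy⟩, (eval_twist x).symm⟩
  · rintro ⟨x, ⟨hx, h⟩, rfl⟩
    refine ⟨(twist_mem_proj_prolongation_iff hx).2 h, ?_⟩
    rwa [← dom_chart, mem_dom_chart, coeffMatrix_twist]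

end Locus

end LinDeg

theorem proposition5 (K : Type*) [Field K] [CharZero K] :
    ∃ E₁ E₂ : Set (LinDeg.Jet K 2),
      LinDeg.secondOrderLocus K = E₁ ∪ E₂ ∧
      LinDeg.components (LinDeg.secondOrderLocus K) = {E₁, E₂} ∧
      LinDeg.IsClosedIn (LinDeg.nondegenerate K) E₁ ∧
      LinDeg.IsIrred E₁ ∧ LinDeg.codim E₁ = 24 ∧
      LinDeg.IsClosedIn (LinDeg.nondegenerate K) E₂ ∧
      LinDeg.IsIrred E₂ ∧ LinDeg.codim E₂ = 30 ∧
      LinDeg.IsClosedIn (LinDeg.nondegenerate K) (E₁ ∩ E₂) ∧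
      LinDeg.IsIrred (E₁ ∩ E₂) ∧ LinDeg.codim (E₁ ∩ E₂) = 34 := by
  have : Infinite K := Infinite.of_injective _ (Nat.cast_injective (R := K))
  have h₀ := LinDeg.origin_mem_dom_chart (K := K)
  set E₁ := (LinDeg.chart K).image (LinDeg.origin K) (LinearMap.ker (LinDeg.cubicConditions K))
    with hE₁
  set E₂ := (LinDeg.chart K).image (LinDeg.origin K) (LinearMap.ker (LinDeg.quarticConditions K))
    with hE₂
  have hE : E₁ ∩ E₂ =
      (LinDeg.chart K).image (LinDeg.origin K) (LinearMap.ker (LinDeg.conditions K)) := by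
    rw [LinDeg.ker_conditions, LinDeg.PolyChart.image_inf]
  have c₁ : LinDeg.codim E₁ = 24 := by
    rw [hE₁, (LinDeg.chart K).codim_image_ker h₀ _ LinDeg.cubicConditions_surjective]
    rfl
  have c₂ : LinDeg.codim E₂ = 30 := by
    rw [hE₂, (LinDeg.chart K).codim_image_ker h₀ _ LinDeg.quarticConditions_surjective]
    rfl
  have c₁₂ : LinDeg.codim (E₁ ∩ E₂) = 34 := by
    rw [hE, (LinDeg.chart K).codim_image_ker h₀ _ LinDeg.conditions_surjective]
    rfl
  have z₁ : LinDeg.IsClosedIn (LinDeg.nondegenerate K) E₁ :=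
    LinDeg.dom_chart (K := K) ▸ (LinDeg.chart K).isClosedIn_image _ _
  have z₂ : LinDeg.IsClosedIn (LinDeg.nondegenerate K) E₂ :=
    LinDeg.dom_chart (K := K) ▸ (LinDeg.chart K).isClosedIn_image _ _
  have i₁ : LinDeg.IsIrred E₁ := (LinDeg.chart K).isIrred_image h₀ _
  have i₂ : LinDeg.IsIrred E₂ := (LinDeg.chart K).isIrred_image h₀ _
  have n₁ : ¬ E₁ ⊆ E₂ := by
    intro h
    rw [Set.inter_eq_left.2 h, c₁] at c₁₂
    exact absurd c₁₂ (by decide)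
  have n₂ : ¬ E₂ ⊆ E₁ := by
    intro h
    rw [Set.inter_eq_right.2 h, c₂] at c₁₂
    exact absurd c₁₂ (by decide)
  refine ⟨E₁, E₂, LinDeg.secondOrderLocus_eq, ?_, z₁, i₁, c₁, z₂, i₂, c₂, z₁.inter z₂, ?_, c₁₂⟩
  · rw [LinDeg.secondOrderLocus_eq]
    exact LinDeg.components_union z₁ z₂ i₁ i₂ n₁ n₂
  · rw [hE]
    exact (LinDeg.chart K).isIrred_image h₀ _
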